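/- Let $\Bbbk$ be a field, $q\in\Bbbk^\times$ and $n\ge 1$. Let $\sigma_a=(a,a+1)\in\mathfrak S_n$. Write $\operatorname{SetPar}_n$ for the set partitions of $\{1,\dots,n\}$, ordered by $A\subseteq B$ iff every block of $B$ is a union of blocks of $A$; write $a\sim_A b$ if $a,b$ lie in the same block of $A$. Write $\operatorname{OrdSetPar}_n$ for the ordered set partitions $A^{\rm ord}=(A_1,\dots,A_k)$ of $\{1,\dots,n\}$, with underlying set partition $A=\{A_1,\dots,A_k\}$ and the natural action of $\mathfrak S_n$, and $f_n=|\operatorname{OrdSetPar}_n|$ (the $n$-th Fubini number). All algebras below are associative unital $\Bbbk$-algebras given by generators and relations. * For $d\geq 1$ invertible in $\Bbbk$, the Yokonuma-Hecke algebra $\mathcal Y_{d,n}(q)$ has generators $g_1,\dots,g_{n-1},t_1,\dots,t_n$ and relations $t_a^d=1$, $t_at_b=t_bt_a$, $t_ag_b=g_bt_{\sigma_b(a)}$, $g_a^2=q+(q-1)e_ag_a$ where $e_a=\frac1d\sum_{r=0}^{d-1}t_a^rt_{a+1}^{-r}$, $g_ag_bg_a=g_bg_ag_b$ if $|a-b|=1$,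 and $g_ag_b=g_bg_a$ if $|a-b|>1$. If $\xi\in\Bbbk$ is a primitive $d$-th root of unity and $A^{\rm ord}\in\operatorname{OrdSetPar}_n$, put $$\overline e(A^{\rm ord})=\sum_{\boldsymbol j}\ \prod_{a=1}^n\ \prod_{\substack{1\le r\le d\\ r\ne j_a}}\frac{t_a-\xi^{r}}{\xi^{j_a}-\xi^{r}}\in\mathcal Y_{d,n}(q),$$ where $\boldsymbol j$ runs over the $\boldsymbol j\in\{1,\dots,d\}^n$ such that removing the empty sets from $(\{a: j_a=1\},\dots,\{a:j_a=d\})$ gives $A^{\rm ord}$. * The bt-algebra $\mathcal E_n(q)$ has generators $g_1,\dots,g_{n-1},e_1,\dots,e_{n-1}$ and relations $g_ae_a=e_ag_a$, $e_ae_b=e_be_a$, $e_a^2=e_a$, $g_a^2=q+(q-1)e_ag_a$; for $|a-b|=1$: $g_ag_bg_a=g_bg_ag_b$, $e_ag_bg_a=g_bg_ae_b$, $e_ae_bg_b=e_ag_be_a=g_be_ae_b$; for $|a-b|>1$: $g_ag_b=g_bg_a$, $g_ae_b=e_bg_a$. Here $g_a^{-1}=q^{-1}g_a+(q^{-1}-1)e_a$.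 For $a<b$ let $e_{ab}=e_{ba}=g_{b-1}\cdots g_{a+1}e_ag_{a+1}^{-1}\cdots g_{b-1}^{-1}$, let $e_{aa}=1$, and put $e(A)=\prod_{a\sim_Ab}e_{ab}$ and $\overline e(A)=\sum_{B\supseteq A}\mu(A,B)e(B)$ for $A\in\operatorname{SetPar}_n$, with $\mu$ the Möbius function of $(\operatorname{SetPar}_n,\subseteq)$; equivalently, $e(A)=\sum_{B\supseteq A}\overline e(B)$ for all $A$. * The ordered bt-algebra $\mathcal E^{\rm ord}_n(q)$ has generators $g_1,\dots,g_{n-1}$ and $\overline e(A^{\rm ord})$ for $A^{\rm ord}\in\operatorname{OrdSetPar}_n$, and relations $\sum_{A^{\rm ord}}\overline e(A^{\rm ord})=1$, $\overline e(A^{\rm ord})\overline e(B^{\rm ord})=\delta_{A^{\rm ord}B^{\rm ord}}\overline e(A^{\rm ord})$, $g_a\overline e(A^{\rm ord})=\overline e(\sigma_aA^{\rm ord})g_a$, $g_a^2\overline e(A^{\rm ord})=q\,\overline e(A^{\rm ord})$ if $a\not\sim_Aa+1$, $g_a^2\overline e(A^{\rm ord})=(q+(q-1)g_a)\overline e(A^{\rm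 ord})$ if $a\sim_Aa+1$, $g_ag_bg_a=g_bg_ag_b$ if $|a-b|=1$, and $g_ag_b=g_bg_a$ if $|a-b|>1$. **Theorem.** (1) Let $d\ge n$ be invertible in $\Bbbk$ and let $\xi\in\Bbbk$ be a primitive $d$-th root of unity. Then there is an injective $\Bbbk$-algebra homomorphism $\epsilon:\mathcal E^{\rm ord}_n(q)\to\mathcal Y_{d,n}(q)$ with $\epsilon(g_a)=g_a$ for $1\le a<n$ and $\epsilon(\overline e(A^{\rm ord}))=\overline e(A^{\rm ord})$ for all $A^{\rm ord}\in\operatorname{OrdSetPar}_n$, and there is an injective $\Bbbk$-algebra homomorphism $\epsilon_1:\mathcal E_n(q)\to\mathcal E^{\rm ord}_n(q)$ with $\epsilon_1(g_a)=g_a$ for $1\le a<n$ and $$\epsilon_1(\overline e(A))=\sum_{\substack{B^{\rm ord}\in\operatorname{OrdSetPar}_n\\ B=A}}\overline e(B^{\rm ord})\qquad(A\in\operatorname{SetPar}_n).$$ (2) For every field $\Bbbk$ and every $q\in\Bbbk^\times$, $\mathcal E^{\rm ord}_n(q)$ is finite-dimensional over $\Bbbk$ and $\dim_\Bbbk\mathcal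 E^{\rm ord}_n(q)=n!\,f_n$. -/

import Mathlib

open Finset

noncomputable section

namespace BraidsTies

/-! ### Set partitions and ordered set partitions

The set `{1, …, n}` is modelled by `Fin n`, and the indices `1 ≤ a < n` of the simple
transpositions by `Fin (n - 1)`: the index `a` exchanges the positions `a` and `a + 1`. -/

/-- The position `a`. -/
def lo {n : ℕ} (a : Fin (n - 1)) : Fin n := ⟨a, by omega⟩

/-- The position `a + 1`. -/
def hi {n : ℕ} (a : Fin (n - 1)) : Fin n := ⟨a + 1, by omega⟩

/-- The simple transposition `σ_a = (a, a + 1)`. -/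
def simpleTransposition {n : ℕ} (a : Fin (n - 1)) : Equiv.Perm (Fin n) :=
  Equiv.swap (lo a) (hi a)

/-- `|a - b| = 1`. -/
def Near {n : ℕ} (a b : Fin (n - 1)) : Prop := (a : ℕ) + 1 = b ∨ (b : ℕ) + 1 = a

/-- `|a - b| > 1`. -/
def Far {n : ℕ} (a b : Fin (n - 1)) : Prop := (a : ℕ) + 1 < b ∨ (b : ℕ) + 1 < a

/-- Set partitions of `{1, …, n}`, as equivalence relations. The order `A ≤ B` of `Setoid` says
that `a ∼_A b` implies `a ∼_B b`, that is, that each block of `B` is a union of blocks of `A`. -/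
abbrev SetPar (n : ℕ) : Type := Setoid (Fin n)

instance (n : ℕ) : Finite (SetPar n) :=
  Finite.of_injective (fun A : SetPar n => (A.r : Fin n → Fin n → Prop)) fun _ _ h =>
    Setoid.ext fun a b => by
      have := congrFun (congrFun h a) b
      exact Iff.of_eq this

instance (n : ℕ) : Fintype (SetPar n) := Fintype.ofFinite _

open Classical in
instance (n : ℕ) : DecidableEq (SetPar n) := inferInstance

open Classical in
instance (n : ℕ) : LocallyFiniteOrder (SetPar n) := Fintype.toLocallyFiniteOrder

/-- An ordered set partition of `{1, …, n}`: a tuple of non-empty, pairwise disjoint blocks that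
cover `{1, …, n}`. -/
@[ext]
structure OrdSetPar (n : ℕ) where
  blocks : List (Finset (Fin n))
  nonempty : ∀ s ∈ blocks, s.Nonempty
  disjoint : blocks.Pairwise Disjoint
  cover : ∀ a : Fin n, ∃ s ∈ blocks, a ∈ s

namespace OrdSetPar

theorem nodup {n : ℕ} (A : OrdSetPar n) : A.blocks.Nodup :=
  List.Pairwise.imp_of_mem (fun {s t} hs _ hst h => by
    subst h
    exact (A.nonempty s hs).ne_empty (disjoint_self.mp hst)) A.disjoint

instance (n : ℕ) : Finite (OrdSetPar n) :=
  Finite.of_injective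
    (fun A : OrdSetPar n => (⟨A.blocks, A.nodup⟩ : {l : List (Finset (Fin n)) // l.Nodup}))
    fun _ _ h => OrdSetPar.ext (congrArg Subtype.val h)

instance (n : ℕ) : Fintype (OrdSetPar n) := Fintype.ofFinite _

open Classical in
instance (n : ℕ) : DecidableEq (OrdSetPar n) := inferInstance

theorem eq_of_mem {n : ℕ} (A : OrdSetPar n) {s t : Finset (Fin n)} (hs : s ∈ A.blocks)
    (ht : t ∈ A.blocks) {a : Fin n} (has : a ∈ s) (hat : a ∈ t) : s = t := by
  by_contra hne
  have hd : Disjoint s t := A.disjoint.forall hs ht hne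
  exact Finset.disjoint_left.mp hd has hat

/-- The set partition that underlies an ordered set partition. -/
@[reducible]
def toSetPar {n : ℕ} (A : OrdSetPar n) : SetPar n where
  r a b := ∃ s ∈ A.blocks, a ∈ s ∧ b ∈ s
  iseqv :=
    { refl := fun a => by
        obtain ⟨s, hs, ha⟩ := A.cover a
        exact ⟨s, hs, ha, ha⟩
      symm := fun ⟨s, hs, ha, hb⟩ => ⟨s, hs, hb, ha⟩
      trans := fun {a b c} ⟨s, hs, ha, hb⟩ ⟨t, ht, hb', hc⟩ => by
        obtain rfl := A.eq_of_mem hs ht hb hb'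
        exact ⟨s, hs, ha, hc⟩ }

/-- The action of the symmetric group on ordered set partitions. -/
def perm {n : ℕ} (σ : Equiv.Perm (Fin n)) (A : OrdSetPar n) : OrdSetPar n where
  blocks := A.blocks.map fun s => s.map σ.toEmbedding
  nonempty := by
    intro s hs
    obtain ⟨u, hu, rfl⟩ := List.mem_map.mp hs
    exact (A.nonempty u hu).map
  disjoint := by
    rw [List.pairwise_map]
    exact A.disjoint.imp fun h => (Finset.disjoint_map _).mpr h
  cover := by
    intro a
    obtain ⟨s, hs, ha⟩ := A.cover (σ.symm a)
    exact ⟨_, List.mem_map.mpr ⟨s, hs, rfl⟩, Finset.mem_map.mpr ⟨_, ha, by simp⟩⟩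

/-- The ordered set partition of a function `j`: its fibres over `0, 1, …, d - 1`, in this order,
with the empty ones removed. -/
def ofFun {n d : ℕ} (j : Fin n → Fin d) : OrdSetPar n where
  blocks := ((List.finRange d).map fun p => Finset.univ.filter fun a => j a = p).filter
    fun s => s.Nonempty
  nonempty := by
    intro s hs
    simpa using (List.mem_filter.mp hs).2
  disjoint := by
    refine List.Pairwise.filter _ ?_
    rw [List.pairwise_map]
    refine List.Pairwise.imp (fun {p r} hpr => ?_) (List.nodup_finRange d)
    rw [Finset.disjoint_left]
    intro a hp hr
    exact hpr ((Finset.mem_filter.mp hp).2.symm.trans (Finset.mem_filter.mp hr).2)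
  cover := by
    intro a
    refine ⟨Finset.univ.filter fun b => j b = j a, List.mem_filter.mpr ⟨?_, ?_⟩, by simp⟩
    · exact List.mem_map.mpr ⟨j a, List.mem_finRange _, rfl⟩
    · simpa using ⟨a, by simp⟩

end OrdSetPar

/-- The Fubini number `f_n`: the number of ordered set partitions of `{1, …, n}`. -/
def fubini (n : ℕ) : ℕ := Fintype.card (OrdSetPar n)

/-! ### The Yokonuma-Hecke algebra -/

/-- Generators of the Yokonuma-Hecke algebra. -/
inductive YGen (n : ℕ) : Type
  | g (a : Fin (n - 1))
  | t (a : Fin n)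

namespace YGen

variable (𝕜 : Type*) [Field 𝕜] (q : 𝕜) (d : ℕ) {n : ℕ}

/-- The free generator `g_a`. -/
abbrev G (a : Fin (n - 1)) : FreeAlgebra 𝕜 (YGen n) := FreeAlgebra.ι 𝕜 (YGen.g a)

/-- The free generator `t_a`. -/
abbrev T (a : Fin n) : FreeAlgebra 𝕜 (YGen n) := FreeAlgebra.ι 𝕜 (YGen.t a)

/-- The element `e_a = (1 / d) ∑_{r < d} t_a ^ r t_{a+1} ^ (-r)`; as `t_{a+1} ^ d = 1` is imposed,
`t_{a+1} ^ (-r)` is written `t_{a+1} ^ (d - r)`. -/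
def E (a : Fin (n - 1)) : FreeAlgebra 𝕜 (YGen n) :=
  (d : 𝕜)⁻¹ • ∑ r ∈ range d, T 𝕜 (lo a) ^ r * T 𝕜 (hi a) ^ (d - r)

/-- Defining relations of the Yokonuma-Hecke algebra. -/
inductive Rel : FreeAlgebra 𝕜 (YGen n) → FreeAlgebra 𝕜 (YGen n) → Prop
  | t_pow (a : Fin n) : Rel (T 𝕜 a ^ d) 1
  | t_comm (a b : Fin n) : Rel (T 𝕜 a * T 𝕜 b) (T 𝕜 b * T 𝕜 a)
  | t_g (a : Fin n) (b : Fin (n - 1)) :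
      Rel (T 𝕜 a * G 𝕜 b) (G 𝕜 b * T 𝕜 (simpleTransposition b a))
  | quadratic (a : Fin (n - 1)) :
      Rel (G 𝕜 a ^ 2) (algebraMap 𝕜 _ q + (q - 1) • (E 𝕜 d a * G 𝕜 a))
  | braid (a b : Fin (n - 1)) (h : Near a b) :
      Rel (G 𝕜 a * G 𝕜 b * G 𝕜 a) (G 𝕜 b * G 𝕜 a * G 𝕜 b)
  | far (a b : Fin (n - 1)) (h : Far a b) : Rel (G 𝕜 a * G 𝕜 b) (G 𝕜 b * G 𝕜 a)

end YGen

/-- The Yokonuma-Hecke algebra `Y_{d,n}(q)` over `𝕜`. -/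
abbrev YokonumaHecke (𝕜 : Type*) [Field 𝕜] (q : 𝕜) (d n : ℕ) : Type _ :=
  RingQuot (YGen.Rel 𝕜 q d (n := n))

namespace YokonumaHecke

variable {𝕜 : Type*} [Field 𝕜] (q : 𝕜) (d : ℕ) {n : ℕ}

/-- The generator `g_a`. -/
def g (a : Fin (n - 1)) : YokonumaHecke 𝕜 q d n :=
  RingQuot.mkAlgHom 𝕜 (YGen.Rel 𝕜 q d) (YGen.G 𝕜 a)

/-- The generator `t_a`. -/
def t (a : Fin n) : YokonumaHecke 𝕜 q d n :=
  RingQuot.mkAlgHom 𝕜 (YGen.Rel 𝕜 q d) (YGen.T 𝕜 a)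

/-- For a `d`-th root of unity `ξ`, the projector
`∏_{r ≠ p} (t_a - ξ ^ r) / (ξ ^ p - ξ ^ r)`, where `1 ≤ r ≤ d`, onto the eigenspace of `t_a` for the
eigenvalue `ξ ^ p`. The index `p` of type `Fin d` stands for the number `p + 1` in `{1, …, d}`. -/
def proj (ξ : 𝕜) (a : Fin n) (p : Fin d) : YokonumaHecke 𝕜 q d n :=
  Polynomial.aeval (t q d a)
    (Lagrange.basis Finset.univ (fun r : Fin d => ξ ^ ((r : ℕ) + 1)) p)

/-- The projector `e(𝐣) = ∏_a e_a(j_a)` onto the joint eigenspace on which `t_a` acts by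
`ξ ^ j_a` for all `a`. The factors commute. -/
def eJ (ξ : 𝕜) (j : Fin n → Fin d) : YokonumaHecke 𝕜 q d n :=
  (List.ofFn fun a => proj q d ξ a (j a)).prod

/-- The idempotent `ē(A^ord)`: the sum of the `e(𝐣)` over those `𝐣` whose non-empty fibres over
`1, …, d`, in this order, are the blocks of `A^ord`. -/
def eBar (ξ : 𝕜) (A : OrdSetPar n) : YokonumaHecke 𝕜 q d n :=
  ∑ j ∈ Finset.univ.filter (fun j : Fin n → Fin d => OrdSetPar.ofFun j = A), eJ q d ξ j

end YokonumaHecke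

/-! ### The bt-algebra -/

/-- Generators of the bt-algebra. -/
inductive BTGen (n : ℕ) : Type
  | g (a : Fin (n - 1))
  | e (a : Fin (n - 1))

namespace BTGen

variable (𝕜 : Type*) [Field 𝕜] (q : 𝕜) {n : ℕ}

/-- The free generator `g_a`. -/
abbrev G (a : Fin (n - 1)) : FreeAlgebra 𝕜 (BTGen n) := FreeAlgebra.ι 𝕜 (BTGen.g a)

/-- The free generator `e_a`. -/
abbrev E (a : Fin (n - 1)) : FreeAlgebra 𝕜 (BTGen n) := FreeAlgebra.ι 𝕜 (BTGen.e a)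

/-- Defining relations of the bt-algebra. -/
inductive Rel : FreeAlgebra 𝕜 (BTGen n) → FreeAlgebra 𝕜 (BTGen n) → Prop
  | g_e (a : Fin (n - 1)) : Rel (G 𝕜 a * E 𝕜 a) (E 𝕜 a * G 𝕜 a)
  | braid (a b : Fin (n - 1)) (h : Near a b) :
      Rel (G 𝕜 a * G 𝕜 b * G 𝕜 a) (G 𝕜 b * G 𝕜 a * G 𝕜 b)
  | far (a b : Fin (n - 1)) (h : Far a b) : Rel (G 𝕜 a * G 𝕜 b) (G 𝕜 b * G 𝕜 a)
  | e_g_g (a b : Fin (n - 1)) (h : Near a b) :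
      Rel (E 𝕜 a * G 𝕜 b * G 𝕜 a) (G 𝕜 b * G 𝕜 a * E 𝕜 b)
  | e_e_g (a b : Fin (n - 1)) (h : Near a b) :
      Rel (E 𝕜 a * E 𝕜 b * G 𝕜 b) (E 𝕜 a * G 𝕜 b * E 𝕜 a)
  | e_g_e (a b : Fin (n - 1)) (h : Near a b) :
      Rel (E 𝕜 a * G 𝕜 b * E 𝕜 a) (G 𝕜 b * E 𝕜 a * E 𝕜 b)
  | e_comm (a b : Fin (n - 1)) : Rel (E 𝕜 a * E 𝕜 b) (E 𝕜 b * E 𝕜 a)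
  | g_e_far (a b : Fin (n - 1)) (h : Far a b) : Rel (G 𝕜 a * E 𝕜 b) (E 𝕜 b * G 𝕜 a)
  | e_sq (a : Fin (n - 1)) : Rel (E 𝕜 a ^ 2) (E 𝕜 a)
  | quadratic (a : Fin (n - 1)) :
      Rel (G 𝕜 a ^ 2) (algebraMap 𝕜 _ q + (q - 1) • (E 𝕜 a * G 𝕜 a))

end BTGen

/-- The bt-algebra `E_n(q)` over `𝕜`. -/
abbrev BT (𝕜 : Type*) [Field 𝕜] (q : 𝕜) (n : ℕ) : Type _ :=
  RingQuot (BTGen.Rel 𝕜 q (n := n))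

namespace BT

variable {𝕜 : Type*} [Field 𝕜] (q : 𝕜) {n : ℕ}

/-- The generator `g_a`. -/
def g (a : Fin (n - 1)) : BT 𝕜 q n := RingQuot.mkAlgHom 𝕜 (BTGen.Rel 𝕜 q) (BTGen.G 𝕜 a)

/-- The generator `e_a`. -/
def e (a : Fin (n - 1)) : BT 𝕜 q n := RingQuot.mkAlgHom 𝕜 (BTGen.Rel 𝕜 q) (BTGen.E 𝕜 a)

/-- The inverse `q⁻¹ g_a + (q⁻¹ - 1) e_a` of `g_a`. -/
def gInv (a : Fin (n - 1)) : BT 𝕜 q n := q⁻¹ • g q a + (q⁻¹ - 1) • e q a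

/-- The element `e_{a,b}` for `b = a + k + 1`, by `e_{a,a+1} = e_a` and
`e_{a,b+1} = g_b e_{a,b} g_b⁻¹`. -/
def tieAux (a : ℕ) : (k : ℕ) → a + k + 1 < n → BT 𝕜 q n
  | 0, h => e q ⟨a, by omega⟩
  | k + 1, h =>
      g q ⟨a + k + 1, by omega⟩ * tieAux a k (by omega) * gInv q ⟨a + k + 1, by omega⟩

/-- The element `e_{ab} = e_{ba}`, with `e_{aa} = 1`. -/
def tie (a b : Fin n) : BT 𝕜 q n :=
  if h : a < b then tieAux q a (b - a - 1) (by omega)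
  else if h : b < a then tieAux q b (a - b - 1) (by omega)
  else 1

open Classical in
/-- The element `e(A) = ∏_{a ∼ b} e_{ab}`. The factors commute. -/
def eA (A : SetPar n) : BT 𝕜 q n :=
  (((List.finRange n ×ˢ List.finRange n).filter fun x => A x.1 x.2).map
    fun x => tie q x.1 x.2).prod

open Classical in
/-- The element `ē(A) = ∑_{A ≤ B} μ(A, B) e(B)`, with the Möbius function of the poset of set
partitions. -/
def eBar (A : SetPar n) : BT 𝕜 q n :=
  ∑ B ∈ Finset.univ.filter (fun B : SetPar n => A ≤ B),
    ((IncidenceAlgebra.mu ℤ A B : ℤ) : 𝕜) • eA q B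

open Classical in
/-- The equations `e(A) = ∑_{A ≤ B} ē(B)` that characterize the elements `ē(B)`. -/
theorem sum_eBar (A : SetPar n) :
    ∑ B ∈ Finset.univ.filter (fun B : SetPar n => A ≤ B), eBar q B = eA (𝕜 := 𝕜) q A := by
  unfold eBar
  rw [Finset.sum_comm' (t' := Finset.univ.filter (fun C : SetPar n => A ≤ C))
    (s' := fun C => Finset.Icc A C)]
  · have key : ∀ C : SetPar n,
        ∑ B ∈ Finset.Icc A C, ((IncidenceAlgebra.mu ℤ B C : ℤ) : 𝕜) • eA (𝕜 := 𝕜) q C =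
          if A = C then eA (𝕜 := 𝕜) q C else 0 := by
      intro C
      rw [← Finset.sum_smul, ← Int.cast_sum, IncidenceAlgebra.sum_Icc_mu_left]
      split_ifs <;> simp
    rw [Finset.sum_congr rfl fun C _ => key C]
    simp
  · intro B C
    simp only [Finset.mem_filter, Finset.mem_univ, true_and, Finset.mem_Icc]
    exact ⟨fun h => ⟨h, h.1.trans h.2⟩, fun h => h.1⟩

end BT

/-! ### The ordered bt-algebra -/

/-- Generators of the ordered bt-algebra. -/
inductive OrdBTGen (n : ℕ) : Type
  | g (a : Fin (n - 1))
  | e (A : OrdSetPar n)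

namespace OrdBTGen

variable (𝕜 : Type*) [Field 𝕜] (q : 𝕜) {n : ℕ}

/-- The free generator `g_a`. -/
abbrev G (a : Fin (n - 1)) : FreeAlgebra 𝕜 (OrdBTGen n) := FreeAlgebra.ι 𝕜 (OrdBTGen.g a)

/-- The free generator `ē(A^ord)`. -/
abbrev E (A : OrdSetPar n) : FreeAlgebra 𝕜 (OrdBTGen n) := FreeAlgebra.ι 𝕜 (OrdBTGen.e A)

/-- Defining relations of the ordered bt-algebra. -/
inductive Rel : FreeAlgebra 𝕜 (OrdBTGen n) → FreeAlgebra 𝕜 (OrdBTGen n) → Prop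
  | e_sum : Rel (∑ A, E 𝕜 A) 1
  | e_mul (A B : OrdSetPar n) : Rel (E 𝕜 A * E 𝕜 B) (if A = B then E 𝕜 A else 0)
  | g_e (a : Fin (n - 1)) (A : OrdSetPar n) :
      Rel (G 𝕜 a * E 𝕜 A) (E 𝕜 (A.perm (simpleTransposition a)) * G 𝕜 a)
  | quadratic_not_tied (a : Fin (n - 1)) (A : OrdSetPar n) (h : ¬ A.toSetPar (lo a) (hi a)) :
      Rel (G 𝕜 a ^ 2 * E 𝕜 A) (q • E 𝕜 A)
  | quadratic_tied (a : Fin (n - 1)) (A : OrdSetPar n) (h : A.toSetPar (lo a) (hi a)) :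
      Rel (G 𝕜 a ^ 2 * E 𝕜 A) ((algebraMap 𝕜 _ q + (q - 1) • G 𝕜 a) * E 𝕜 A)
  | braid (a b : Fin (n - 1)) (h : Near a b) :
      Rel (G 𝕜 a * G 𝕜 b * G 𝕜 a) (G 𝕜 b * G 𝕜 a * G 𝕜 b)
  | far (a b : Fin (n - 1)) (h : Far a b) : Rel (G 𝕜 a * G 𝕜 b) (G 𝕜 b * G 𝕜 a)

end OrdBTGen

/-- The ordered bt-algebra `E^ord_n(q)` over `𝕜`. -/
abbrev OrdBT (𝕜 : Type*) [Field 𝕜] (q : 𝕜) (n : ℕ) : Type _ :=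
  RingQuot (OrdBTGen.Rel 𝕜 q (n := n))

namespace OrdBT

variable {𝕜 : Type*} [Field 𝕜] (q : 𝕜) {n : ℕ}

/-- The generator `g_a`. -/
def g (a : Fin (n - 1)) : OrdBT 𝕜 q n :=
  RingQuot.mkAlgHom 𝕜 (OrdBTGen.Rel 𝕜 q) (OrdBTGen.G 𝕜 a)

/-- The generator `ē(A^ord)`. -/
def eBar (A : OrdSetPar n) : OrdBT 𝕜 q n :=
  RingQuot.mkAlgHom 𝕜 (OrdBTGen.Rel 𝕜 q) (OrdBTGen.E 𝕜 A)

end OrdBT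

end BraidsTies

end

namespace BraidsTies

/-! The ordered bt-algebra and the bt-algebra behave like Hecke algebras over the span of a family
of idempotents. Conjugation by the braid generators permutes the family, and `g a * g a` has the
form `x + g a * y` with `x`, `y` in the span. The rewriting that brings words in the symmetric group
to normal form then shows that the `n!` normal forms `nf`, multiplied by the idempotents, span the
algebra (`IsHeckeBase.g_mul_mem`).

Linear independence comes from one explicit module, `WordRep.Space`. Its basis consists of
permutations, read as words, together with a colour datum that ties some of the letters. A generator
exchanges two adjacent letters; if they are in descending order there is a factor `q`, and a
correction `q - 1` if they are also tied. The braid relation only needs being tied to be an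
equivalence relation (`WordRep.opG_braid`). A normal form applied to the identity word never meets a
descent, so it yields a single basis vector, and distinct normal forms yield distinct permutations.
With ordered set partitions as colours this is a module over the ordered bt-algebra, and the
spanning set is a basis, which gives the dimension. With functions to `Fin d` as colours it is a
module over the Yokonuma-Hecke algebra.

Both injectivity statements follow from one principle, `injective_of_span_of_linearIndependent`: the
spanning family goes to normal forms times sums of idempotents over the fibres of a surjection, and
such a family is independent. For `ε` the surjection is `OrdSetPar.ofFun`, which is onto because `n
≤ d`; for `ε₁` it is `OrdSetPar.toSetPar`. The map `ε` exists because the `e(𝐣)` are a complete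
system of joint eigenprojectors of the `t a`, so that relations can be tested on each of them. The
map `ε₁` sends `e a` to the sum of the idempotents in which `a` and `a + 1` are tied; then `e(A)`
acts on `ē(C)` as `1` or `0` according to whether `A ≤ C`, and Möbius inversion gives the formula
for `ē(A)`.

What remains is that the `e(A)` form a suitable base of the bt-algebra. Conjugation by the
generators permutes the ties `e_{ij}` as transpositions permute positions (`BT.conj_smul_tie`), so
each tie is conjugate to the first one. The identities between ties (`BT.commute_tie`,
`BT.tie_mul_self`, `BT.tie_mul_tie`) therefore only need a check against the first generator `e`. -/

theorem simpleTransposition_mul_self {n : ℕ} (a : Fin (n - 1)) :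
    simpleTransposition a * simpleTransposition a = 1 := Equiv.swap_mul_self _ _

theorem simpleTransposition_inv {n : ℕ} (a : Fin (n - 1)) :
    (simpleTransposition a)⁻¹ = simpleTransposition a := Equiv.swap_inv _ _

theorem simpleTransposition_apply_apply {n : ℕ} (a : Fin (n - 1)) (b : Fin n) :
    simpleTransposition a (simpleTransposition a b) = b := by
  simp [simpleTransposition]

theorem simpleTransposition_lo {n : ℕ} (a : Fin (n - 1)) :
    simpleTransposition a (lo a) = hi a := Equiv.swap_apply_left _ _

theorem simpleTransposition_hi {n : ℕ} (a : Fin (n - 1)) :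
    simpleTransposition a (hi a) = lo a := Equiv.swap_apply_right _ _

theorem simpleTransposition_of_ne {n : ℕ} (a : Fin (n - 1)) (b : Fin n) (h₁ : (b : ℕ) ≠ a)
    (h₂ : (b : ℕ) ≠ a + 1) : simpleTransposition a b = b :=
  Equiv.swap_apply_of_ne_of_ne (fun h => h₁ (congrArg Fin.val h)) fun h => h₂ (congrArg Fin.val h)

theorem lo_ne_hi {n : ℕ} (a : Fin (n - 1)) : lo a ≠ hi a := fun h => by
  have := congrArg Fin.val h
  simp [lo, hi] at this

theorem simpleTransposition_commute {n : ℕ} {a b : Fin (n - 1)} (h : Far a b) :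
    simpleTransposition a * simpleTransposition b =
      simpleTransposition b * simpleTransposition a := by
  refine (Equiv.Perm.Disjoint.commute fun x => ?_).eq
  by_cases h₁ : (x : ℕ) = a ∨ (x : ℕ) = a + 1
  · right
    rcases h with h | h <;> exact simpleTransposition_of_ne _ _ (by omega) (by omega)
  · left
    exact simpleTransposition_of_ne _ _ (by omega) (by omega)

theorem simpleTransposition_braid {n : ℕ} {a b : Fin (n - 1)} (h : Near a b) :
    simpleTransposition a * simpleTransposition b * simpleTransposition a =
      simpleTransposition b * simpleTransposition a * simpleTransposition b := by
  have key : ∀ {a b : Fin (n - 1)}, (a : ℕ) + 1 = b →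
      simpleTransposition a * simpleTransposition b * simpleTransposition a =
        simpleTransposition b * simpleTransposition a * simpleTransposition b := by
    intro a b h
    have hb : lo b = hi a := Fin.ext h.symm
    have h₁ : lo a ≠ hi b := fun h' => by
      have := congrArg Fin.val h'
      simp [lo, hi] at this
      omega
    unfold simpleTransposition
    rw [hb, Equiv.swap_mul_swap_mul_swap (lo_ne_hi a) h₁, Equiv.swap_comm (lo a),
      Equiv.swap_comm (hi a) (hi b), Equiv.swap_mul_swap_mul_swap (hb ▸ (lo_ne_hi b).symm) h₁.symm,
      Equiv.swap_comm]
  rcases h with h | h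
  · exact key h
  · exact (key h).symm

/-! ### Ordered set partitions: permutation action and fibres of functions -/

namespace OrdSetPar

theorem toSetPar_iff {n : ℕ} (A : OrdSetPar n) (a b : Fin n) :
    A.toSetPar a b ↔ ∃ s ∈ A.blocks, a ∈ s ∧ b ∈ s := Iff.rfl

theorem perm_one {n : ℕ} (A : OrdSetPar n) : A.perm 1 = A := by
  ext1
  simp [perm, Equiv.Perm.one_def]

theorem perm_mul {n : ℕ} (σ τ : Equiv.Perm (Fin n)) (A : OrdSetPar n) :
    A.perm (σ * τ) = (A.perm τ).perm σ := by
  ext1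
  simp only [perm, List.map_map]
  refine List.map_congr_left fun s _ => ?_
  simp only [Function.comp, Finset.map_map]
  rfl

theorem perm_toSetPar {n : ℕ} (σ : Equiv.Perm (Fin n)) (A : OrdSetPar n) (a b : Fin n) :
    (A.perm σ).toSetPar a b ↔ A.toSetPar (σ⁻¹ a) (σ⁻¹ b) := by
  simp [toSetPar_iff, perm, Finset.mem_map_equiv]

theorem perm_toSetPar_apply {n : ℕ} (σ : Equiv.Perm (Fin n)) (A : OrdSetPar n) (a b : Fin n) :
    (A.perm σ).toSetPar (σ a) (σ b) ↔ A.toSetPar a b := by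
  rw [perm_toSetPar]
  simp

/-- Exchanging two elements of one block preserves every block as a set. This is what makes the
correction term of a tied pair compatible with the idempotents. -/
theorem perm_swap {n : ℕ} (A : OrdSetPar n) {a b : Fin n} (h : A.toSetPar a b) :
    A.perm (Equiv.swap a b) = A := by
  obtain ⟨s, hs, ha, hb⟩ := h
  ext1
  refine (List.map_congr_left fun u hu => ?_).trans (List.map_id _)
  have key : a ∈ u ↔ b ∈ u :=
    ⟨fun h => A.eq_of_mem hs hu ha h ▸ hb, fun h => A.eq_of_mem hs hu hb h ▸ ha⟩
  ext x
  rw [Finset.mem_map_equiv, Equiv.symm_swap, id]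
  rcases eq_or_ne x a with rfl | hxa
  · rw [Equiv.swap_apply_left, key]
  rcases eq_or_ne x b with rfl | hxb
  · rw [Equiv.swap_apply_right, key]
  rw [Equiv.swap_apply_of_ne_of_ne hxa hxb]

theorem perm_inj {n : ℕ} (σ : Equiv.Perm (Fin n)) {A B : OrdSetPar n} :
    A.perm σ = B.perm σ ↔ A = B := by
  refine ⟨fun h => ?_, fun h => h ▸ rfl⟩
  have := congrArg (perm σ⁻¹) h
  rwa [← perm_mul, ← perm_mul, inv_mul_cancel, perm_one, perm_one] at this

theorem mem_ofFun {n d : ℕ} (j : Fin n → Fin d) (s : Finset (Fin n)) :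
    s ∈ (ofFun j).blocks ↔ (∃ p, (Finset.univ.filter fun a => j a = p) = s) ∧ s.Nonempty := by
  simp [ofFun]

theorem ofFun_toSetPar {n d : ℕ} (j : Fin n → Fin d) (a b : Fin n) :
    (ofFun j).toSetPar a b ↔ j a = j b := by
  rw [toSetPar_iff]
  constructor
  · rintro ⟨s, hs, ha, hb⟩
    obtain ⟨⟨p, rfl⟩, -⟩ := (mem_ofFun j s).1 hs
    simp at ha hb
    rw [ha, hb]
  · intro h
    refine ⟨Finset.univ.filter fun c => j c = j b, (mem_ofFun j _).2 ⟨⟨_, rfl⟩, b, ?_⟩, ?_, ?_⟩ <;>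
      simp [h]

theorem ofFun_perm {n d : ℕ} (σ : Equiv.Perm (Fin n)) (j : Fin n → Fin d) :
    (ofFun j).perm σ = ofFun (j ∘ ⇑σ⁻¹) := by
  ext1
  simp only [perm, ofFun]
  have : (List.finRange d).map (fun p => Finset.univ.filter fun a => (j ∘ ⇑σ⁻¹) a = p) =
      ((List.finRange d).map fun p => Finset.univ.filter fun a => j a = p).map
        fun s => s.map σ.toEmbedding := by
    rw [List.map_map]
    refine List.map_congr_left fun p _ => ?_
    ext x
    simp only [Function.comp, Finset.mem_map_equiv, Finset.mem_filter, Finset.mem_univ, true_and]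
    rfl
  rw [this, List.filter_map (l := List.map _ _)]
  congr 1
  refine List.filter_congr fun s _ => ?_
  simp

theorem length_le {n : ℕ} (A : OrdSetPar n) : A.blocks.length ≤ n := by
  have h : ∀ p : Fin A.blocks.length, ∃ a, a ∈ A.blocks[p] :=
    fun p => A.nonempty _ (List.getElem_mem _)
  choose f hf using h
  have hinj : Function.Injective f := by
    intro p r hpr
    have := A.eq_of_mem (List.getElem_mem _) (List.getElem_mem _) (hf p) (hpr ▸ hf r)
    exact Fin.ext ((A.nodup.getElem_inj_iff).1 this)
  simpa using Fintype.card_le_of_injective f hinj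

/-- The map is the list padded with `∅` up to length `d`; removing the empty sets undoes the
padding. -/
theorem filter_map_getElem {α : Type*} (l : List (Finset α)) (hl : ∀ s ∈ l, s.Nonempty) (d : ℕ)
    (h : l.length ≤ d) :
    (((List.finRange d).map fun p : Fin d => l.getD p ∅).filter fun s => s.Nonempty) = l := by
  obtain ⟨k, rfl⟩ := Nat.exists_eq_add_of_le h
  have : ((List.finRange (l.length + k)).map fun p : Fin _ => l.getD p ∅) =
      l ++ List.replicate k ∅ := by
    apply List.ext_getElem
    · simp
    · intro i h₁ h₂
      simp only [List.getElem_map, List.getElem_finRange, List.getElem_append]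
      split_ifs with hi
      · simp [hi]
      · simp [List.getD, List.getElem?_eq_none (not_lt.1 hi)]
  rw [this, List.filter_append, List.filter_eq_self.2 (by simpa using hl)]
  simp

theorem exists_ofFun_eq {n d : ℕ} (h : n ≤ d) (A : OrdSetPar n) :
    ∃ j : Fin n → Fin d, ofFun j = A := by
  have hex : ∀ a, ∃ p : Fin A.blocks.length, a ∈ A.blocks[p] := fun a => by
    obtain ⟨s, hs, ha⟩ := A.cover a
    obtain ⟨i, hi, rfl⟩ := List.getElem_of_mem hs
    exact ⟨⟨i, hi⟩, ha⟩
  choose f hf using hex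
  -- The label of `a` is the index of its block. There are at most `n ≤ d` blocks, and the labels
  -- beyond the last block have empty fibres.
  refine ⟨fun a => Fin.castLE (A.length_le.trans h) (f a), ?_⟩
  ext1
  refine Eq.trans ?_ (filter_map_getElem A.blocks A.nonempty d (A.length_le.trans h))
  simp only [ofFun]
  congr 1
  refine List.map_congr_left fun p _ => ?_
  ext a
  simp only [Finset.mem_filter, Finset.mem_univ, true_and]
  constructor
  · rintro rfl
    simpa using hf a
  · intro ha
    have hp : (p : ℕ) < A.blocks.length := by
      by_contra hp
      simp [List.getD, List.getElem?_eq_none (not_lt.1 hp)] at ha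
    have ha' : a ∈ A.blocks[(p : ℕ)] := by simpa [hp] using ha
    have := A.eq_of_mem (List.getElem_mem _) (List.getElem_mem _) (hf a) ha'
    exact Fin.ext ((A.nodup.getElem_inj_iff).1 this)

theorem exists_toSetPar_eq {n : ℕ} (A : SetPar n) : ∃ B : OrdSetPar n, B.toSetPar = A := by
  -- Any labelling that separates the classes will do; here a chosen representative serves as the
  -- label, with `d = n`.
  refine ⟨ofFun fun a => (Quotient.mk A a).out, Setoid.ext fun a b => ?_⟩
  rw [ofFun_toSetPar]
  refine ⟨fun h => ?_, fun h => congrArg _ (Quotient.sound h)⟩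
  have := congrArg (Quotient.mk A) h
  rw [Quotient.out_eq, Quotient.out_eq] at this
  exact Quotient.exact this

end OrdSetPar

/-! ### Normal forms of words in braid generators -/

section NormalForm

variable {M : Type*} [Monoid M]

/-- The product `g j * g (j + 1) * ⋯ * g (j + l - 1)`. -/
def chain (g : ℕ → M) : ℕ → ℕ → M
  | _, 0 => 1
  | j, l + 1 => g j * chain g (j + 1) l

/-- Index set of the normal forms of elements of the symmetric group on `k + 1` letters. -/
def NF : ℕ → Type
  | 0 => Unit
  | k + 1 => Fin (k + 2) × NF k

instance instFintypeNF : (k : ℕ) → Fintype (NF k)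
  | 0 => inferInstanceAs (Fintype Unit)
  | k + 1 => letI := instFintypeNF k; inferInstanceAs (Fintype (Fin (k + 2) × NF k))

theorem card_NF (k : ℕ) : Fintype.card (NF k) = (k + 1).factorial := by
  induction k with
  | zero => rfl
  | succ k ih =>
    have : Fintype.card (NF (k + 1)) = Fintype.card (Fin (k + 2) × NF k) := rfl
    rw [this, Fintype.card_prod, ih, Fintype.card_fin, ← Nat.factorial_succ]

/-- The normal form with index `u`, a product of elements `g j * ⋯ * g k`. -/
def nf (g : ℕ → M) : (k : ℕ) → NF k → M
  | 0, _ => 1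
  | k + 1, u => chain g u.1 (k + 1 - u.1) * nf g k u.2

theorem map_chain {M' : Type*} [Monoid M'] (φ : M →* M') (g : ℕ → M) (j l : ℕ) :
    φ (chain g j l) = chain (fun a => φ (g a)) j l := by
  induction l generalizing j with
  | zero => simp [chain]
  | succ l ih => simp [chain, ih]

theorem map_nf {M' : Type*} [Monoid M'] (φ : M →* M') (g : ℕ → M) (k : ℕ) (u : NF k) :
    φ (nf g k u) = nf (fun a => φ (g a)) k u := by
  induction k with
  | zero => simp [nf]
  | succ k ih => simp [nf, ih, map_chain]

/-- Extension by `1` of a family indexed by the generators of the braid group. -/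
def natExt {n : ℕ} (f : Fin (n - 1) → M) (a : ℕ) : M := if h : a < n - 1 then f ⟨a, h⟩ else 1

theorem natExt_of_lt {n : ℕ} (f : Fin (n - 1) → M) {a : ℕ} (h : a < n - 1) :
    natExt f a = f ⟨a, h⟩ := dif_pos h

theorem map_natExt {M' : Type*} [Monoid M'] (φ : M →* M') {n : ℕ} (f : Fin (n - 1) → M) (a : ℕ) :
    φ (natExt f a) = natExt (fun a => φ (f a)) a := by
  unfold natExt
  split_ifs <;> simp

theorem map_nf_natExt {M' : Type*} [Monoid M'] (φ : M →* M') {n : ℕ} (f : Fin (n - 1) → M)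
    (k : ℕ) (u : NF k) : φ (nf (natExt f) k u) = nf (natExt fun a => φ (f a)) k u := by
  rw [map_nf]
  congr 1
  funext a
  exact map_natExt φ f a

variable {R : Type*} [Ring R]

/-- The relations of the braid monoid on `N` generators. -/
structure IsBraidFamily (g : ℕ → R) (N : ℕ) : Prop where
  braid : ∀ a, a + 1 < N → g a * g (a + 1) * g a = g (a + 1) * g a * g (a + 1)
  far : ∀ a b, a + 1 < b → b < N → g a * g b = g b * g a

theorem IsBraidFamily.mul_chain_of_lt {g : ℕ → R} {N : ℕ} (hg : IsBraidFamily g N) (a j l : ℕ)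
    (h : a + 1 < j) (hN : j + l ≤ N) : g a * chain g j l = chain g j l * g a := by
  induction l generalizing j with
  | zero => simp [chain]
  | succ l ih =>
    simp only [chain]
    rw [← mul_assoc, hg.far a j h (by omega), mul_assoc, ih (j + 1) (by omega) (by omega),
      mul_assoc]

/-- The generator commutes with the factors below `a`, crosses `g a * g (a + 1)` by a braid move,
which lowers its index by one, and commutes with the factors that follow. -/
theorem IsBraidFamily.mul_chain_of_gt {g : ℕ → R} {N : ℕ} (hg : IsBraidFamily g N) (a j l : ℕ)
    (h : j ≤ a) (h' : a + 1 < j + l) (hN : j + l ≤ N) :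
    g (a + 1) * chain g j l = chain g j l * g a := by
  induction l generalizing j with
  | zero => omega
  | succ l ih =>
    rcases h.eq_or_lt with rfl | h
    · obtain ⟨l, rfl⟩ : ∃ m, l = m + 1 := ⟨l - 1, by omega⟩
      simp only [chain]
      rw [← mul_assoc, ← mul_assoc, ← hg.braid j (by omega), mul_assoc,
        hg.mul_chain_of_lt j (j + 1 + 1) l (by omega) (by omega)]
      simp only [mul_assoc]
    · simp only [chain]
      rw [← mul_assoc, ← hg.far j (a + 1) (by omega) (by omega), mul_assoc,
        ih (j + 1) (by omega) (by omega) (by omega), mul_assoc]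

variable {𝕜 : Type*} [Field 𝕜] [Algebra 𝕜 R]

/-- A subspace `D` over which the elements `g a` behave as generators of a Hecke algebra. -/
structure IsHeckeBase (g : ℕ → R) (N : ℕ) (D : Submodule 𝕜 R) : Prop extends
    IsBraidFamily g N where
  one_mem : (1 : R) ∈ D
  mul_mem : ∀ x ∈ D, ∀ y ∈ D, x * y ∈ D
  mul_g : ∀ a < N, ∀ x ∈ D, ∃ y ∈ D, x * g a = g a * y
  quadratic : ∀ a < N, ∃ x ∈ D, ∃ y ∈ D, g a * g a = x + g a * y

/-- The span of the products `nf g k u * x` with `x ∈ D`. -/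
def nfSpan (g : ℕ → R) (D : Submodule 𝕜 R) (k : ℕ) : Submodule 𝕜 R :=
  Submodule.span 𝕜 {z | ∃ u : NF k, ∃ x ∈ D, z = nf g k u * x}

theorem nf_mul_mem_nfSpan (g : ℕ → R) (D : Submodule 𝕜 R) {k : ℕ} (u : NF k) {x : R}
    (hx : x ∈ D) : nf g k u * x ∈ nfSpan g D k := Submodule.subset_span ⟨u, x, hx, rfl⟩

theorem chain_mul_mem_nfSpan (g : ℕ → R) (D : Submodule 𝕜 R) {k j : ℕ} (hj : j ≤ k + 1) {z : R}
    (hz : z ∈ nfSpan g D k) : chain g j (k + 1 - j) * z ∈ nfSpan g D (k + 1) := by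
  refine Submodule.span_induction (p := fun z _ => chain g j (k + 1 - j) * z ∈ nfSpan g D (k + 1))
    ?_ ?_ ?_ ?_ hz
  · rintro z ⟨u, x, hx, rfl⟩
    rw [← mul_assoc]
    exact nf_mul_mem_nfSpan (k := k + 1) g D (⟨j, by omega⟩, u) hx
  · simp
  · intro x y _ _ hx hy
    rw [mul_add]
    exact add_mem hx hy
  · intro c x _ hx
    rw [mul_smul_comm]
    exact Submodule.smul_mem _ _ hx

theorem nfSpan_succ_induction (g : ℕ → R) (D : Submodule 𝕜 R) {k : ℕ} (y : R)
    (S : Submodule 𝕜 R)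
    (h : ∀ j ≤ k + 1, ∀ z ∈ nfSpan g D k, y * (chain g j (k + 1 - j) * z) ∈ S) :
    ∀ z ∈ nfSpan g D (k + 1), y * z ∈ S := by
  intro z hz
  refine Submodule.span_induction (p := fun z _ => y * z ∈ S) ?_ ?_ ?_ ?_ hz
  · rintro z ⟨u, x, hx, rfl⟩
    have := h u.1 (by have := u.1.2; omega) _ (nf_mul_mem_nfSpan g D u.2 hx)
    rwa [← mul_assoc (chain _ _ _)] at this
  · simp
  · intro x y _ _ hx hy
    rw [mul_add]
    exact add_mem hx hy
  · intro c x _ hx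
    rw [mul_smul_comm]
    exact Submodule.smul_mem _ _ hx

variable {g : ℕ → R} {N : ℕ} {D : Submodule 𝕜 R}

theorem IsHeckeBase.mul_chain (hD : IsHeckeBase g N D) (j l : ℕ) (h : j + l ≤ N) (x : R)
    (hx : x ∈ D) : ∃ y ∈ D, x * chain g j l = chain g j l * y := by
  induction l generalizing j x with
  | zero => exact ⟨x, hx, by simp [chain]⟩
  | succ l ih =>
    obtain ⟨y, hy, h₁⟩ := hD.mul_g j (by omega) x hx
    obtain ⟨z, hz, h₂⟩ := ih (j + 1) (by omega) y hy
    exact ⟨z, hz, by simp only [chain]; rw [← mul_assoc, h₁, mul_assoc, h₂, mul_assoc]⟩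

theorem IsHeckeBase.mul_nf (hD : IsHeckeBase g N D) (k : ℕ) (hk : k ≤ N) (u : NF k) (x : R)
    (hx : x ∈ D) : ∃ y ∈ D, x * nf g k u = nf g k u * y := by
  induction k generalizing x with
  | zero => exact ⟨x, hx, by simp [nf]⟩
  | succ k ih =>
    have := u.1.2
    obtain ⟨y, hy, h₁⟩ := hD.mul_chain u.1 (k + 1 - u.1) (by omega) x hx
    obtain ⟨z, hz, h₂⟩ := ih (by omega) u.2 y hy
    exact ⟨z, hz, by simp only [nf]; rw [← mul_assoc, h₁, mul_assoc, h₂, mul_assoc]⟩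

theorem IsHeckeBase.base_mul_mem (hD : IsHeckeBase g N D) (k : ℕ) (hk : k ≤ N) (x : R)
    (hx : x ∈ D) (z : R) (hz : z ∈ nfSpan g D k) : x * z ∈ nfSpan g D k := by
  refine Submodule.span_induction (p := fun z _ => x * z ∈ nfSpan g D k) ?_ ?_ ?_ ?_ hz
  · rintro z ⟨u, y, hy, rfl⟩
    obtain ⟨x', hx', h⟩ := hD.mul_nf k hk u x hx
    rw [← mul_assoc, h, mul_assoc]
    exact nf_mul_mem_nfSpan g D u (hD.mul_mem _ hx' _ hy)
  · simp
  · intro x y _ _ hx hy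
    rw [mul_add]
    exact add_mem hx hy
  · intro c x _ hx
    rw [mul_smul_comm]
    exact Submodule.smul_mem _ _ hx

/-- Compare `a` with the start `j` of the leading chain. If `a + 1 < j`, the generator passes
through the chain; if `a + 1 = j`, it lengthens the chain; if `a = j`, the quadratic relation
applies; if `a > j`, it passes with its index lowered. Whatever has passed the chain is absorbed by
the shorter normal form, by induction. -/
theorem IsHeckeBase.g_mul_mem (hD : IsHeckeBase g N D) (k : ℕ) (hk : k ≤ N) (a : ℕ)
    (ha : a < k) (z : R) (hz : z ∈ nfSpan g D k) : g a * z ∈ nfSpan g D k := by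
  induction k generalizing a z with
  | zero => omega
  | succ k ih =>
    refine nfSpan_succ_induction g D _ _ (fun j hj z hz => ?_) z hz
    rcases lt_trichotomy (a + 1) j with h | rfl | h
    · rw [← mul_assoc, hD.mul_chain_of_lt a j _ h (by omega), mul_assoc]
      exact chain_mul_mem_nfSpan g D hj (ih (by omega) a (by omega) z hz)
    · have := chain_mul_mem_nfSpan g D (show a ≤ k + 1 by omega) hz
      rw [show k + 1 - a = k + 1 - (a + 1) + 1 by omega] at this
      simpa only [chain, mul_assoc] using this
    · rcases (show j ≤ a by omega).eq_or_lt with rfl | h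
      -- The square `g j * g j` becomes `x + g j * y`. Both coefficients are pushed through the rest
      -- of the chain and absorbed on the right, which leaves a chain starting at `j + 1` and one
      -- starting at `j`.
      · obtain ⟨x, hx, y, hy, hq⟩ := hD.quadratic j (by omega)
        obtain ⟨x', hx', h₁⟩ := hD.mul_chain (j + 1) (k + 1 - (j + 1)) (by omega) x hx
        obtain ⟨y', hy', h₂⟩ := hD.mul_chain (j + 1) (k + 1 - (j + 1)) (by omega) y hy
        have m₁ := chain_mul_mem_nfSpan g D (show j + 1 ≤ k + 1 by omega)
          (hD.base_mul_mem k (by omega) x' hx' z hz)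
        have m₂ := chain_mul_mem_nfSpan g D (show j ≤ k + 1 by omega)
          (hD.base_mul_mem k (by omega) y' hy' z hz)
        rw [show k + 1 - j = k + 1 - (j + 1) + 1 by omega] at m₂ ⊢
        have e : g j * (chain g j (k + 1 - (j + 1) + 1) * z) =
            chain g (j + 1) (k + 1 - (j + 1)) * (x' * z) +
              chain g j (k + 1 - (j + 1) + 1) * (y' * z) := by
          simp only [chain]
          calc _ = (g j * g j) * chain g (j + 1) (k + 1 - (j + 1)) * z := by
                simp only [mul_assoc]
            _ = _ := by
                rw [hq, add_mul, h₁, mul_assoc (g j), h₂, add_mul]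
                simp only [mul_assoc]
        rw [e]
        exact add_mem m₁ m₂
      · obtain ⟨a, rfl⟩ : ∃ b, a = b + 1 := ⟨a - 1, by omega⟩
        rw [← mul_assoc, hD.mul_chain_of_gt a j _ (by omega) (by omega) (by omega), mul_assoc]
        exact chain_mul_mem_nfSpan g D hj (ih (by omega) a (by omega) z hz)

theorem IsHeckeBase.one_mem_nfSpan (hD : IsHeckeBase g N D) (k : ℕ) :
    (1 : R) ∈ nfSpan g D k := by
  induction k with
  | zero => simpa [nf] using nf_mul_mem_nfSpan (k := 0) g D () hD.one_mem
  | succ k ih => simpa [chain] using chain_mul_mem_nfSpan g D (le_refl (k + 1)) ih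

theorem nfSpan_span (g : ℕ → R) (k : ℕ) {ι : Type*} (e : ι → R) :
    nfSpan g (Submodule.span 𝕜 (Set.range e)) k =
      Submodule.span 𝕜 (Set.range fun x : NF k × ι => nf g k x.1 * e x.2) := by
  apply le_antisymm
  · refine Submodule.span_le.2 ?_
    rintro _ ⟨u, x, hx, rfl⟩
    have : Submodule.span 𝕜 (Set.range e) ≤ (Submodule.span 𝕜
        (Set.range fun x : NF k × ι => nf g k x.1 * e x.2)).comap
          (LinearMap.mulLeft 𝕜 (nf g k u)) := by
      refine Submodule.span_le.2 ?_
      rintro _ ⟨i, rfl⟩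
      exact Submodule.subset_span ⟨(u, i), rfl⟩
    exact this hx
  · refine Submodule.span_le.2 ?_
    rintro _ ⟨x, rfl⟩
    exact nf_mul_mem_nfSpan g _ _ (Submodule.subset_span ⟨_, rfl⟩)

/-- A subspace of a quotient of a free algebra that contains `1` and is stable under left
multiplication by the generators is everything. -/
theorem eq_top_of_generators_mul_mem {X : Type*} (φ : FreeAlgebra 𝕜 X →ₐ[𝕜] R)
    (hφ : Function.Surjective φ) (S : Submodule 𝕜 R) (h₁ : (1 : R) ∈ S)
    (h : ∀ x, ∀ z ∈ S, φ (FreeAlgebra.ι 𝕜 x) * z ∈ S) : S = ⊤ := by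
  have key : ∀ f : FreeAlgebra 𝕜 X, ∀ z ∈ S, φ f * z ∈ S := by
    intro f
    refine FreeAlgebra.induction 𝕜 X (motive := fun f => ∀ z ∈ S, φ f * z ∈ S) ?_ h ?_ ?_ f
    · intro r z hz
      rw [AlgHom.commutes, ← Algebra.smul_def]
      exact S.smul_mem _ hz
    · intro a b ha hb z hz
      rw [map_mul, mul_assoc]
      exact ha _ (hb _ hz)
    · intro a b ha hb z hz
      rw [map_add, add_mul]
      exact add_mem (ha _ hz) (hb _ hz)
  refine Submodule.eq_top_iff'.2 fun x => ?_
  obtain ⟨f, rfl⟩ := hφ x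
  simpa using key f 1 h₁

/-- A linear map that sends a spanning family to a linearly independent one is injective. -/
theorem injective_of_span_of_linearIndependent {M N ι : Type*} [AddCommGroup M] [Module 𝕜 M]
    [AddCommGroup N] [Module 𝕜 N] (φ : M →ₗ[𝕜] N) (v : ι → M)
    (hv : Submodule.span 𝕜 (Set.range v) = ⊤) (h : LinearIndependent 𝕜 fun i => φ (v i)) :
    Function.Injective φ := by
  have hi : LinearIndependent 𝕜 v := LinearIndependent.of_comp φ h
  let b := Module.Basis.mk hi hv.ge
  rw [← LinearMap.ker_eq_bot, LinearMap.ker_eq_bot']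
  intro m hm
  have h' : (fun i => φ (v i)) = φ ∘ b := by
    funext i
    simp [b]
  rw [← b.linearCombination_repr m, Finsupp.apply_linearCombination, ← h'] at hm
  have := (linearIndependent_iff.1 h) _ hm
  simpa using this

end NormalForm

/-! ### A representation on coloured permutations -/

namespace WordRep

variable {𝕜 : Type*} [Field 𝕜] (q : 𝕜) {n : ℕ} {C : Type*} (tied : C → SetPar n)

/-- The space with a basis of pairs of a permutation, seen as a word whose letter at the position
`p` is `x p`, and a colour datum. -/
abbrev Space (𝕜 : Type*) [Field 𝕜] (n : ℕ) (C : Type*) : Type _ :=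
  (Equiv.Perm (Fin n) × C) →₀ 𝕜

/-- The basis vector of a word. -/
noncomputable def bas (x : Equiv.Perm (Fin n)) (c : C) : Space 𝕜 n C := Finsupp.single (x, c) 1

theorem hom_ext {M : Type*} [AddCommGroup M] [Module 𝕜 M] {f f' : Space 𝕜 n C →ₗ[𝕜] M}
    (h : ∀ x c, f (bas x c) = f' (bas x c)) : f = f' :=
  Finsupp.lhom_ext' fun y => LinearMap.ext_ring (h y.1 y.2)

open Classical in
/-- The coefficient that a pair of letters in wrong order contributes. -/
noncomputable def tieCoeff (c : C) (i j : Fin n) : 𝕜 := if tied c i j then q - 1 else 0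

theorem tieCoeff_symm (c : C) (i j : Fin n) : tieCoeff q tied c i j = tieCoeff q tied c j i := by
  unfold tieCoeff
  rw [Setoid.comm']

/-- The action of the generator `g a`. -/
noncomputable def opG (a : Fin (n - 1)) : Module.End 𝕜 (Space 𝕜 n C) :=
  Finsupp.linearCombination 𝕜 fun y =>
    if y.1 (lo a) < y.1 (hi a) then bas (y.1 * simpleTransposition a) y.2
    else q • bas (y.1 * simpleTransposition a) y.2 +
      tieCoeff q tied y.2 (y.1 (lo a)) (y.1 (hi a)) • bas y.1 y.2

theorem opG_bas (a : Fin (n - 1)) (x : Equiv.Perm (Fin n)) (c : C) :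
    opG q tied a (bas x c) =
      if x (lo a) < x (hi a) then bas (x * simpleTransposition a) c
      else q • bas (x * simpleTransposition a) c +
        tieCoeff q tied c (x (lo a)) (x (hi a)) • bas x c := by
  simp [opG, bas]

theorem mul_simpleTransposition_cancel (x : Equiv.Perm (Fin n)) (a : Fin (n - 1)) :
    x * simpleTransposition a * simpleTransposition a = x := by
  rw [mul_assoc, simpleTransposition_mul_self, mul_one]

/-- The exchange turns an ascent into a descent, so exactly one of the two applications contributes
the factor `q`. The tied pair is then read in the other order, which is why the symmetry of
`tieCoeff` enters. -/
theorem opG_opG_bas (a : Fin (n - 1)) (x : Equiv.Perm (Fin n)) (c : C) :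
    opG q tied a (opG q tied a (bas x c)) =
      q • bas x c + tieCoeff q tied c (x (lo a)) (x (hi a)) • opG q tied a (bas x c) := by
  have hne : x (lo a) ≠ x (hi a) := fun h => lo_ne_hi a (x.injective h)
  rcases hne.lt_or_gt with h | h
  · simp [opG_bas, h, h.not_gt, simpleTransposition_lo, simpleTransposition_hi,
      mul_simpleTransposition_cancel, tieCoeff_symm q tied c (x (hi a))]
  · simp [opG_bas, h, h.not_gt, simpleTransposition_lo, simpleTransposition_hi,
      mul_simpleTransposition_cancel]

theorem opG_far {a b : Fin (n - 1)} (h : Far a b) :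
    opG q tied a * opG q tied b = (opG q tied b * opG q tied a : Module.End 𝕜 (Space 𝕜 n C)) := by
  refine hom_ext fun x c => ?_
  have e := simpleTransposition_commute h
  have h₁ : simpleTransposition a (lo b) = lo b := by
    apply simpleTransposition_of_ne <;> rcases h with h | h <;> simp [lo] <;> omega
  have h₂ : simpleTransposition a (hi b) = hi b := by
    apply simpleTransposition_of_ne <;> rcases h with h | h <;> simp [hi] <;> omega
  have h₃ : simpleTransposition b (lo a) = lo a := by
    apply simpleTransposition_of_ne <;> rcases h with h | h <;> simp [lo] <;> omega
  have h₄ : simpleTransposition b (hi a) = hi a := by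
    apply simpleTransposition_of_ne <;> rcases h with h | h <;> simp [hi] <;> omega
  have e' : x * simpleTransposition a * simpleTransposition b =
      x * simpleTransposition b * simpleTransposition a := by rw [mul_assoc, e, mul_assoc]
  by_cases ha : x (lo a) < x (hi a) <;> by_cases hb : x (lo b) < x (hi b) <;>
    simp [opG_bas, ha, hb, h₁, h₂, h₃, h₄, e'] <;>
    module

/-- Only the relative order of three letters matters. In each of the six orders both sides are
combinations of the same words, and the coefficients agree by the identities that express that ties
form an equivalence relation. -/
theorem opG_braid_succ {a b : Fin (n - 1)} (h : (a : ℕ) + 1 = b) :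
    opG q tied a * opG q tied b * opG q tied a =
      (opG q tied b * opG q tied a * opG q tied b : Module.End 𝕜 (Space 𝕜 n C)) := by
  refine hom_ext fun x c => ?_
  have hb : lo b = hi a := Fin.ext h.symm
  have h₁ : simpleTransposition a (hi b) = hi b := by
    apply simpleTransposition_of_ne <;> simp [hi] <;> omega
  have h₂ : simpleTransposition b (lo a) = lo a := by
    apply simpleTransposition_of_ne <;> simp [lo] <;> omega
  have h₃ : simpleTransposition b (hi a) = hi b := hb ▸ simpleTransposition_lo b
  have h₄ : simpleTransposition b (hi b) = hi a := hb ▸ simpleTransposition_hi b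
  have h₅ := simpleTransposition_lo a
  have h₆ := simpleTransposition_hi a
  have e : x * simpleTransposition b * simpleTransposition a * simpleTransposition b =
      x * simpleTransposition a * simpleTransposition b * simpleTransposition a := by
    have := simpleTransposition_braid (Or.inl h : Near a b)
    simp only [mul_assoc] at this ⊢
    rw [this]
  have n₁ : x (lo a) ≠ x (hi a) := fun h => lo_ne_hi a (x.injective h)
  have n₂ : x (hi a) ≠ x (hi b) := fun h => lo_ne_hi b (hb ▸ x.injective h)
  have n₃ : x (lo a) ≠ x (hi b) := fun h' => by
    have := congrArg Fin.val (x.injective h')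
    simp [lo, hi] at this
    omega
  have s₁ := tieCoeff_symm q tied c (x (hi a)) (x (lo a))
  have s₂ := tieCoeff_symm q tied c (x (hi b)) (x (hi a))
  have s₃ := tieCoeff_symm q tied c (x (hi b)) (x (lo a))
  -- Two ties among three letters force the third, and every coefficient is `0` or `q - 1`. These
  -- four identities are all that the comparison of coefficients uses.
  have r : tieCoeff q tied c (x (lo a)) (x (hi a)) * tieCoeff q tied c (x (hi a)) (x (hi b)) =
        tieCoeff q tied c (x (lo a)) (x (hi b)) * tieCoeff q tied c (x (hi a)) (x (hi b)) ∧
      tieCoeff q tied c (x (lo a)) (x (hi a)) * tieCoeff q tied c (x (hi a)) (x (hi b)) =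
        tieCoeff q tied c (x (lo a)) (x (hi a)) * tieCoeff q tied c (x (lo a)) (x (hi b)) ∧
      tieCoeff q tied c (x (lo a)) (x (hi a)) ^ 2 =
        (q - 1) * tieCoeff q tied c (x (lo a)) (x (hi a)) ∧
      tieCoeff q tied c (x (hi a)) (x (hi b)) ^ 2 =
        (q - 1) * tieCoeff q tied c (x (hi a)) (x (hi b)) := by
    unfold tieCoeff
    by_cases t₁ : tied c (x (lo a)) (x (hi a)) <;> by_cases t₂ : tied c (x (hi a)) (x (hi b)) <;>
      by_cases t₃ : tied c (x (lo a)) (x (hi b)) <;> simp [t₁, t₂, t₃] <;> try ring1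
    · exact (t₃ ((tied c).trans' t₁ t₂)).elim
    · exact (t₂ ((tied c).trans' ((tied c).symm' t₁) t₃)).elim
    · exact (t₁ ((tied c).trans' t₃ ((tied c).symm' t₂))).elim
  obtain ⟨r₁, r₂, r₃, r₄⟩ := r
  rcases n₁.lt_or_gt with o₁ | o₁ <;> rcases n₂.lt_or_gt with o₂ | o₂ <;>
    rcases n₃.lt_or_gt with o₃ | o₃ <;>
    first
    | (exfalso; order)
    | (simp only [Module.End.mul_apply, opG_bas, hb, Equiv.Perm.mul_apply, h₁, h₂, h₃, h₄, h₅, h₆,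
        o₁, o₂, o₃, o₁.not_gt, o₂.not_gt, o₃.not_gt, if_true, if_false, map_add, map_smul,
        mul_simpleTransposition_cancel, e, s₁, s₂]
       done)
    | (simp only [Module.End.mul_apply, opG_bas, hb, Equiv.Perm.mul_apply, h₁, h₂, h₃, h₄, h₅, h₆,
        o₁, o₂, o₃, o₁.not_gt, o₂.not_gt, o₃.not_gt, if_true, if_false, map_add, map_smul,
        mul_simpleTransposition_cancel, e, s₁, s₂]
       generalize tieCoeff q tied c (x (lo a)) (x (hi a)) = A at *
       generalize tieCoeff q tied c (x (hi a)) (x (hi b)) = B at *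
       generalize tieCoeff q tied c (x (lo a)) (x (hi b)) = T at *
       match_scalars <;>
        first
        | ring1
        | linear_combination r₁ - r₂
        | linear_combination r₂ - r₁
        | linear_combination q * r₁
        | linear_combination -q * r₁
        | linear_combination q * r₂
        | linear_combination -q * r₂
        | linear_combination B * r₃ - A * r₄)

theorem opG_braid {a b : Fin (n - 1)} (h : Near a b) :
    opG q tied a * opG q tied b * opG q tied a =
      (opG q tied b * opG q tied a * opG q tied b : Module.End 𝕜 (Space 𝕜 n C)) := by
  rcases h with h | h
  · exact opG_braid_succ q tied h
  · exact (opG_braid_succ q tied h).symm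

/-- The permutations `s a` with junk value `1`. -/
noncomputable def sN (n : ℕ) : ℕ → Equiv.Perm (Fin n) := natExt simpleTransposition

theorem sN_of_gt (a : ℕ) (i : Fin n) (h : a + 1 < i) : sN n a i = i := by
  unfold sN natExt
  split_ifs
  · exact simpleTransposition_of_ne _ _ (by simp; omega) (by simp; omega)
  · rfl

theorem chain_sN_of_gt (j l : ℕ) (i : Fin n) (h : j + l < i) : chain (sN n) j l i = i := by
  induction l generalizing j with
  | zero => rfl
  | succ l ih =>
    rw [chain, Equiv.Perm.mul_apply, ih (j + 1) (by omega), sN_of_gt j i (by omega)]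

theorem chain_sN_top (j l : ℕ) (h : j + l < n) :
    chain (sN n) j l ⟨j + l, h⟩ = ⟨j, by omega⟩ := by
  induction l generalizing j with
  | zero => rfl
  | succ l ih =>
    have e : (⟨j + (l + 1), h⟩ : Fin n) = ⟨j + 1 + l, by omega⟩ := Fin.ext (by simp; omega)
    rw [chain, Equiv.Perm.mul_apply, e, ih (j + 1) (by omega), sN, natExt_of_lt _ (by omega)]
    exact simpleTransposition_hi (n := n) ⟨j, by omega⟩

theorem nf_sN_of_gt (k : ℕ) (u : NF k) (i : Fin n) (h : k < i) : nf (sN n) k u i = i := by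
  induction k with
  | zero => rfl
  | succ k ih =>
    have := u.1.2
    rw [nf, Equiv.Perm.mul_apply, ih _ (by omega), chain_sN_of_gt _ _ _ (by omega)]

/-- The shorter normal form fixes the position `k + 1` and the chain sends it to its starting index.
That index can thus be read off the permutation; cancelling the chain leaves the induction
hypothesis. -/
theorem nf_sN_injective (k : ℕ) (hk : k < n) : Function.Injective (nf (sN n) k) := by
  induction k with
  | zero => exact fun _ _ _ => rfl
  | succ k ih =>
    have top : ∀ u : NF (k + 1), nf (sN n) (k + 1) u ⟨k + 1, hk⟩ = ⟨u.1, by omega⟩ := by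
      intro u
      have := u.1.2
      have e : (⟨k + 1, hk⟩ : Fin n) = ⟨u.1 + (k + 1 - u.1), by omega⟩ :=
        Fin.ext (by simp; omega)
      rw [nf, Equiv.Perm.mul_apply, nf_sN_of_gt _ _ _ (by simp), e, chain_sN_top]
    intro u v h
    have h₁ : u.1 = v.1 := by
      have := (top u).symm.trans ((congrArg (fun σ => σ ⟨k + 1, hk⟩) h).trans (top v))
      exact Fin.ext (Fin.mk.inj this)
    have h₂ : u.2 = v.2 := by
      refine ih (by omega) ?_
      rw [nf, nf, h₁] at h
      exact mul_left_cancel h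
    exact Prod.ext h₁ h₂

/-- The chain carries the letter `k` leftwards from position `k` to position `j`. Every letter it
passes is smaller, so only the ascent case of `opG` occurs and no coefficient or correction appears.
The last two conclusions are the invariants that keep the induction going. -/
theorem chain_opG_bas (k : ℕ) (hk : k < n) (c : C) (x : Equiv.Perm (Fin n))
    (hx : ∀ i : Fin n, (i : ℕ) ≤ k → (x i : ℕ) ≤ k) (hxk : x ⟨k, hk⟩ = ⟨k, hk⟩) (j l : ℕ)
    (h : j + l = k) :
    chain (natExt (opG q tied)) j l (bas x c) = bas (x * (chain (sN n) j l)⁻¹) c ∧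
      (∀ i : Fin n, (i : ℕ) ≤ k → ((x * (chain (sN n) j l)⁻¹) i : ℕ) ≤ k) ∧
      (x * (chain (sN n) j l)⁻¹) ⟨j, by omega⟩ = ⟨k, hk⟩ := by
  induction l generalizing j with
  | zero =>
    obtain rfl : j = k := h
    simpa [chain] using ⟨hx, hxk⟩
  | succ l ih =>
    obtain ⟨h₁, h₂, h₃⟩ := ih (j + 1) (by omega)
    have hj : j < n - 1 := by omega
    set y := x * (chain (sN n) (j + 1) l)⁻¹ with hy
    have e : x * (chain (sN n) j (l + 1))⁻¹ = y * simpleTransposition ⟨j, hj⟩ := by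
      rw [chain, mul_inv_rev, sN, natExt_of_lt _ hj, simpleTransposition_inv, hy, mul_assoc]
      rfl
    have hlo : lo (⟨j, hj⟩ : Fin (n - 1)) = (⟨j, by omega⟩ : Fin n) := rfl
    have hhi : hi (⟨j, hj⟩ : Fin (n - 1)) = (⟨j + 1, by omega⟩ : Fin n) := rfl
    rw [e]
    refine ⟨?_, ?_, ?_⟩
    · rw [chain, Module.End.mul_apply, h₁, natExt_of_lt _ hj, opG_bas, if_pos]
      rw [hhi, h₃, hlo, Fin.lt_def]
      refine lt_of_le_of_ne (h₂ _ (by simp; omega)) fun h' => ?_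
      have := y.injective ((Fin.ext h' : y ⟨j, _⟩ = ⟨k, hk⟩).trans h₃.symm)
      simp at this
    · intro i hi'
      rw [Equiv.Perm.mul_apply]
      apply h₂
      by_cases hi₁ : i = lo ⟨j, hj⟩
      · rw [hi₁, simpleTransposition_lo, hhi]
        simp
        omega
      by_cases hi₂ : i = hi ⟨j, hj⟩
      · rw [hi₂, simpleTransposition_hi, hlo]
        simp
        omega
      · rw [simpleTransposition, Equiv.swap_apply_of_ne_of_ne hi₁ hi₂]
        exact hi'
    · rw [← hlo, Equiv.Perm.mul_apply, simpleTransposition_lo, hhi, h₃]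

/-- The inverse appears because operators compose on the left while exchanges of positions multiply
the word on the right. -/
theorem nf_opG_bas (k : ℕ) (hk : k < n) (u : NF k) (c : C) :
    nf (natExt (opG q tied)) k u (bas 1 c) = bas (nf (sN n) k u)⁻¹ c := by
  induction k with
  | zero => simp [nf]
  | succ k ih =>
    have := u.1.2
    have fix : ∀ i : Fin n, k < i → (nf (sN n) k u.2)⁻¹ i = i := fun i h => by
      rw [Equiv.Perm.inv_eq_iff_eq, nf_sN_of_gt k u.2 i h]
    rw [nf, Module.End.mul_apply, ih (by omega), nf, mul_inv_rev]
    refine (chain_opG_bas q tied (k + 1) hk c _ ?_ (fix _ (by simp)) _ _ (by omega)).1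
    intro i hi
    by_contra h
    have h' := (nf (sN n) k u.2)⁻¹.injective (fix _ (show k < ((nf (sN n) k u.2)⁻¹ i : ℕ) by omega))
    rw [h'] at h
    omega

open Classical in
-- Choose one colour in each fibre of `π` and keep only the coordinates at the chosen colours: each
-- sum over a fibre becomes a single standard basis vector.
theorem linearIndependent_sum_bas [Fintype C] {I : Type*} (π : C → I)
    (hπ : Function.Surjective π) (k : ℕ) (hk : k < n) :
    LinearIndependent 𝕜 fun y : NF k × I =>
      ∑ c ∈ Finset.univ.filter (fun c => π c = y.2),
        (bas (nf (sN n) k y.1)⁻¹ c : Space 𝕜 n C) := by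
  choose s hs using hπ
  let f : NF k × I → Equiv.Perm (Fin n) × C := fun y => ((nf (sN n) k y.1)⁻¹, s y.2)
  have hf : Function.Injective f := by
    rintro ⟨u, i⟩ ⟨v, j⟩ h
    have h₁ := nf_sN_injective k hk (inv_injective (congrArg Prod.fst h))
    have h₂ := congrArg π (congrArg Prod.snd h)
    simp only [f, hs] at h₁ h₂
    exact Prod.ext h₁ h₂
  let L : Space 𝕜 n C →ₗ[𝕜] (NF k × I →₀ 𝕜) := Finsupp.lcomapDomain f hf
  refine LinearIndependent.of_comp L ?_
  have : (L ∘ fun y : NF k × I => ∑ c ∈ Finset.univ.filter (fun c => π c = y.2),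
      (bas (nf (sN n) k y.1)⁻¹ c : Space 𝕜 n C)) = fun y => Finsupp.single y 1 := by
    funext y
    ext z
    simp only [Function.comp, map_sum, Finsupp.finsetSum_apply]
    have e : ∀ c, L (bas (nf (sN n) k y.1)⁻¹ c) z = if y.1 = z.1 ∧ c = s z.2 then 1 else 0 := by
      intro c
      change (Finsupp.single ((nf (sN n) k y.1)⁻¹, c) (1 : 𝕜)) (f z) = _
      rw [Finsupp.single_apply]
      simp only [f, Prod.mk.injEq, inv_inj, (nf_sN_injective k hk).eq_iff]
    simp only [e, Finsupp.single_apply, Prod.ext_iff]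
    by_cases h₁ : y.1 = z.1
    · simp only [h₁, true_and, Finset.sum_ite_eq', Finset.mem_filter, Finset.mem_univ, hs]
      simp only [eq_comm]
    · simp [h₁]
  rw [this]
  exact Finsupp.basisSingleOne.linearIndependent

/-- A diagonal operator. -/
noncomputable def opDiag (f : Equiv.Perm (Fin n) → C → 𝕜) : Module.End 𝕜 (Space 𝕜 n C) :=
  Finsupp.linearCombination 𝕜 fun y => f y.1 y.2 • bas y.1 y.2

theorem opDiag_bas (f : Equiv.Perm (Fin n) → C → 𝕜) (x : Equiv.Perm (Fin n)) (c : C) :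
    opDiag f (bas x c) = f x c • bas x c := by
  simp [opDiag, bas]

end WordRep

/-! ### Hecke bases given by a spanning family -/

theorem isHeckeBase_span {R 𝕜 : Type*} [Ring R] [Field 𝕜] [Algebra 𝕜 R] {g : ℕ → R} {N : ℕ}
    {ι : Type*} (e : ι → R) (hg : IsBraidFamily g N)
    (one_mem : (1 : R) ∈ Submodule.span 𝕜 (Set.range e))
    (mul_mem : ∀ i j, e i * e j ∈ Submodule.span 𝕜 (Set.range e))
    (mul_g : ∀ a < N, ∀ i, ∃ j, e i * g a = g a * e j)
    (quadratic : ∀ a < N, ∃ x ∈ Submodule.span 𝕜 (Set.range e),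
      ∃ y ∈ Submodule.span 𝕜 (Set.range e), g a * g a = x + g a * y) :
    IsHeckeBase g N (Submodule.span 𝕜 (Set.range e)) where
  toIsBraidFamily := hg
  one_mem := one_mem
  mul_mem := by
    have : Submodule.span 𝕜 (Set.range e) * Submodule.span 𝕜 (Set.range e) ≤
        Submodule.span 𝕜 (Set.range e) := by
      rw [Submodule.span_mul_span, Submodule.span_le]
      rintro _ ⟨_, ⟨i, rfl⟩, _, ⟨j, rfl⟩, rfl⟩
      exact mul_mem i j
    exact fun x hx y hy => this (Submodule.mul_mem_mul hx hy)
  mul_g := by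
    intro a ha x hx
    refine Submodule.span_induction (p := fun x _ =>
      ∃ y ∈ Submodule.span 𝕜 (Set.range e), x * g a = g a * y) ?_ ?_ ?_ ?_ hx
    · rintro _ ⟨i, rfl⟩
      obtain ⟨j, hj⟩ := mul_g a ha i
      exact ⟨e j, Submodule.subset_span ⟨j, rfl⟩, hj⟩
    · exact ⟨0, zero_mem _, by simp⟩
    · rintro x y _ _ ⟨x', hx', h₁⟩ ⟨y', hy', h₂⟩
      exact ⟨x' + y', add_mem hx' hy', by rw [add_mul, mul_add, h₁, h₂]⟩
    · rintro c x _ ⟨x', hx', h₁⟩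
      exact ⟨c • x', Submodule.smul_mem _ _ hx', by rw [smul_mul_assoc, mul_smul_comm, h₁]⟩
  quadratic := quadratic

theorem isBraidFamily_natExt {R : Type*} [Ring R] {n : ℕ} (f : Fin (n - 1) → R)
    (braid : ∀ a b, Near a b → f a * f b * f a = f b * f a * f b)
    (far : ∀ a b, Far a b → f a * f b = f b * f a) : IsBraidFamily (natExt f) (n - 1) where
  braid a h := by
    rw [natExt_of_lt f h, natExt_of_lt f (show a < n - 1 by omega)]
    exact braid _ _ (Or.inl rfl)
  far a b h h' := by
    rw [natExt_of_lt f h', natExt_of_lt f (show a < n - 1 by omega)]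
    exact far _ _ (Or.inl h)

/-! ### The ordered bt-algebra: spanning set, module and basis -/

namespace OrdBT

open WordRep

variable {𝕜 : Type*} [Field 𝕜] (q : 𝕜) {n : ℕ}

theorem exists_lift {B : Type*} [Ring B] [Algebra 𝕜 B] (G : Fin (n - 1) → B)
    (E : OrdSetPar n → B) (e_sum : ∑ A, E A = 1)
    (e_mul : ∀ A B, E A * E B = if A = B then E A else 0)
    (g_e : ∀ a A, G a * E A = E (A.perm (simpleTransposition a)) * G a)
    (quadratic_not_tied : ∀ a A, ¬ A.toSetPar (lo a) (hi a) → G a ^ 2 * E A = q • E A)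
    (quadratic_tied : ∀ a A, A.toSetPar (lo a) (hi a) →
      G a ^ 2 * E A = (algebraMap 𝕜 B q + (q - 1) • G a) * E A)
    (braid : ∀ a b, Near a b → G a * G b * G a = G b * G a * G b)
    (far : ∀ a b, Far a b → G a * G b = G b * G a) :
    ∃ φ : OrdBT 𝕜 q n →ₐ[𝕜] B, (∀ a, φ (g q a) = G a) ∧ ∀ A, φ (eBar q A) = E A := by
  let F : OrdBTGen n → B := fun x => match x with
    | .g a => G a
    | .e A => E A
  have hF : ∀ x y, OrdBTGen.Rel 𝕜 q x y → FreeAlgebra.lift 𝕜 F x = FreeAlgebra.lift 𝕜 F y := by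
    intro x y h
    induction h with
    | e_sum => simpa [F] using e_sum
    | e_mul A B =>
      have := e_mul A B
      split_ifs at this ⊢ <;> simpa [F] using this
    | g_e a A => simpa [F] using g_e a A
    | quadratic_not_tied a A h => simpa [F] using quadratic_not_tied a A h
    | quadratic_tied a A h =>
      simpa only [F, map_mul, map_pow, map_add, map_smul, AlgHom.commutes,
        FreeAlgebra.lift_ι_apply] using quadratic_tied a A h
    | braid a b h => simpa [F] using braid a b h
    | far a b h => simpa [F] using far a b h
  refine ⟨RingQuot.liftAlgHom 𝕜 ⟨FreeAlgebra.lift 𝕜 F, fun ⦃x y⦄ => hF x y⟩, fun a => ?_,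
    fun A => ?_⟩
  · rw [g, RingQuot.liftAlgHom_mkAlgHom_apply, FreeAlgebra.lift_ι_apply]
  · rw [eBar, RingQuot.liftAlgHom_mkAlgHom_apply, FreeAlgebra.lift_ι_apply]

theorem sum_eBar : ∑ A : OrdSetPar n, eBar q A = 1 := by
  simpa [eBar] using RingQuot.mkAlgHom_rel 𝕜 (OrdBTGen.Rel.e_sum (𝕜 := 𝕜) (q := q) (n := n))

theorem eBar_mul (A B : OrdSetPar n) :
    eBar q A * eBar q B = if A = B then eBar q A else 0 := by
  have := RingQuot.mkAlgHom_rel 𝕜 (OrdBTGen.Rel.e_mul (𝕜 := 𝕜) (q := q) A B)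
  split_ifs at this ⊢ <;> simpa [eBar] using this

theorem g_mul_eBar (a : Fin (n - 1)) (A : OrdSetPar n) :
    g q a * eBar q A = eBar q (A.perm (simpleTransposition a)) * g q a := by
  simpa [eBar, g] using RingQuot.mkAlgHom_rel 𝕜 (OrdBTGen.Rel.g_e (𝕜 := 𝕜) (q := q) a A)

theorem g_sq_mul_of_not_tied (a : Fin (n - 1)) (A : OrdSetPar n)
    (h : ¬ A.toSetPar (lo a) (hi a)) : g q a ^ 2 * eBar q A = q • eBar q A := by
  simpa [eBar, g] using
    RingQuot.mkAlgHom_rel 𝕜 (OrdBTGen.Rel.quadratic_not_tied (𝕜 := 𝕜) (q := q) a A h)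

theorem g_sq_mul_of_tied (a : Fin (n - 1)) (A : OrdSetPar n)
    (h : A.toSetPar (lo a) (hi a)) :
    g q a ^ 2 * eBar q A = (algebraMap 𝕜 _ q + (q - 1) • g q a) * eBar q A := by
  have := RingQuot.mkAlgHom_rel 𝕜 (OrdBTGen.Rel.quadratic_tied (𝕜 := 𝕜) (q := q) a A h)
  simpa only [eBar, g, map_mul, map_pow, map_add, map_smul, AlgHom.commutes] using this

theorem braid (a b : Fin (n - 1)) (h : Near a b) :
    g q a * g q b * g q a = g q b * g q a * g q b := by
  simpa [g] using RingQuot.mkAlgHom_rel 𝕜 (OrdBTGen.Rel.braid (𝕜 := 𝕜) (q := q) a b h)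

theorem far (a b : Fin (n - 1)) (h : Far a b) : g q a * g q b = g q b * g q a := by
  simpa [g] using RingQuot.mkAlgHom_rel 𝕜 (OrdBTGen.Rel.far (𝕜 := 𝕜) (q := q) a b h)

open Classical in
/-- The idempotent of the ordered set partitions in which `i` and `j` lie in the same block. -/
noncomputable def tieIdem (i j : Fin n) : OrdBT 𝕜 q n :=
  ∑ A ∈ Finset.univ.filter (fun A : OrdSetPar n => A.toSetPar i j), eBar q A

open Classical in
theorem sum_filter_mul_eBar (p : OrdSetPar n → Prop) (A : OrdSetPar n) :
    (∑ B ∈ Finset.univ.filter p, eBar q B) * eBar q A = if p A then eBar q A else 0 := by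
  simp [Finset.sum_mul, eBar_mul, Finset.sum_ite_eq']

/-- The idempotents sum to `1`, so an identity may be tested after right multiplication by each of
them. -/
theorem eq_of_mul_eBar {x y : OrdBT 𝕜 q n} (h : ∀ A, x * eBar q A = y * eBar q A) : x = y := by
  rw [← mul_one x, ← mul_one y, ← sum_eBar, Finset.mul_sum, Finset.mul_sum]
  exact Finset.sum_congr rfl fun A _ => h A

/-- The tied and untied quadratic relations are merged into one formula with coefficients in the
span of the idempotents, as a Hecke base requires. -/
theorem g_sq (a : Fin (n - 1)) :
    g q a ^ 2 = algebraMap 𝕜 _ q + (q - 1) • (g q a * tieIdem q (lo a) (hi a)) := by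
  refine eq_of_mul_eBar q fun A => ?_
  rw [add_mul, smul_mul_assoc, mul_assoc, tieIdem, sum_filter_mul_eBar, ← Algebra.smul_def]
  split_ifs with h
  · rw [g_sq_mul_of_tied q a A h, add_mul, smul_mul_assoc, ← Algebra.smul_def]
  · rw [g_sq_mul_of_not_tied q a A h, mul_zero, smul_zero, add_zero]

theorem isHeckeBase :
    IsHeckeBase (natExt (g (𝕜 := 𝕜) q (n := n))) (n - 1)
      (Submodule.span 𝕜 (Set.range (eBar (𝕜 := 𝕜) q (n := n)))) := by
  have hmem : ∀ A, eBar q A ∈ Submodule.span 𝕜 (Set.range (eBar (𝕜 := 𝕜) q (n := n))) :=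
    fun A => Submodule.subset_span ⟨A, rfl⟩
  have hone : (1 : OrdBT 𝕜 q n) ∈ Submodule.span 𝕜 (Set.range (eBar (𝕜 := 𝕜) q (n := n))) := by
    rw [← sum_eBar]
    exact Submodule.sum_mem _ fun A _ => hmem A
  refine isHeckeBase_span _ (isBraidFamily_natExt _ (braid q) (far q)) hone ?_ ?_ ?_
  · intro A B
    rw [eBar_mul]
    split_ifs
    · exact hmem A
    · exact zero_mem _
  · intro a ha A
    refine ⟨A.perm (simpleTransposition ⟨a, ha⟩), ?_⟩
    rw [natExt_of_lt _ ha, g_mul_eBar, ← OrdSetPar.perm_mul, simpleTransposition_mul_self,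
      OrdSetPar.perm_one]
  · intro a ha
    refine ⟨algebraMap 𝕜 _ q, ?_, (q - 1) • tieIdem q (lo ⟨a, ha⟩) (hi ⟨a, ha⟩), ?_, ?_⟩
    · rw [Algebra.algebraMap_eq_smul_one]
      exact Submodule.smul_mem _ _ hone
    · exact Submodule.smul_mem _ _ (Submodule.sum_mem _ fun A _ => hmem A)
    · rw [natExt_of_lt _ ha, ← sq, g_sq, mul_smul_comm]

theorem span_nf :
    Submodule.span 𝕜 (Set.range fun y : NF (n - 1) × OrdSetPar n =>
      nf (natExt (g q)) (n - 1) y.1 * eBar (𝕜 := 𝕜) q y.2) = ⊤ := by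
  have hD := isHeckeBase (𝕜 := 𝕜) q (n := n)
  rw [← nfSpan_span]
  refine eq_top_of_generators_mul_mem (RingQuot.mkAlgHom 𝕜 (OrdBTGen.Rel 𝕜 q))
    (RingQuot.mkAlgHom_surjective 𝕜 _) _ (hD.one_mem_nfSpan _) ?_
  rintro (a | A) z hz
  · have := hD.g_mul_mem (n - 1) le_rfl a a.2 z hz
    rwa [natExt_of_lt _ a.2] at this
  · exact hD.base_mul_mem (n - 1) le_rfl _ (Submodule.subset_span ⟨A, rfl⟩) z hz

/-- The colour `c` partitions the letters. The word `x` transports it to the partition `c.perm x⁻¹`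
of the positions, and `ē(A)` projects onto the words for which this partition is `A`. -/
theorem exists_rep : ∃ φ : OrdBT 𝕜 q n →ₐ[𝕜] Module.End 𝕜 (Space 𝕜 n (OrdSetPar n)),
    (∀ a, φ (g q a) = opG q OrdSetPar.toSetPar a) ∧
    ∀ A, φ (eBar q A) = opDiag fun x c => if c.perm x⁻¹ = A then 1 else 0 := by
  have tie : ∀ (x : Equiv.Perm (Fin n)) (c : OrdSetPar n) (a : Fin (n - 1)),
      (c.perm x⁻¹).toSetPar (lo a) (hi a) ↔ c.toSetPar (x (lo a)) (x (hi a)) := by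
    intro x c a
    rw [OrdSetPar.perm_toSetPar, inv_inv]
  refine exists_lift q (opG q OrdSetPar.toSetPar)
    (fun A => opDiag fun x c => if c.perm x⁻¹ = A then 1 else 0) ?_ ?_ ?_ ?_ ?_
    (fun a b => opG_braid q _) (fun a b => opG_far q _)
  · refine hom_ext fun x c => ?_
    simp [LinearMap.sum_apply, opDiag_bas]
  · intro A B
    refine hom_ext fun x c => ?_
    by_cases h : c.perm x⁻¹ = B
    · subst h
      by_cases h' : A = c.perm x⁻¹
      · simp [opDiag_bas, h']
      · simp [opDiag_bas, h', Ne.symm h']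
    · by_cases h' : A = B
      · simp [opDiag_bas, h, h']
      · simp [opDiag_bas, h, h']
  · intro a A
    refine hom_ext fun x c => ?_
    have e : c.perm (x * simpleTransposition a)⁻¹ = A.perm (simpleTransposition a) ↔
        c.perm x⁻¹ = A := by
      rw [mul_inv_rev, simpleTransposition_inv, OrdSetPar.perm_mul, OrdSetPar.perm_inj]
    rw [Module.End.mul_apply, Module.End.mul_apply, opDiag_bas, map_smul, opG_bas]
    split_ifs with h₁ h₂ h₂
    · rw [opDiag_bas, if_pos (e.2 h₁)]
    -- The correction term keeps the word, so it needs `A` to be fixed by the transposition. It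
    -- occurs only for tied letters, where `OrdSetPar.perm_swap` supplies this.
    · rw [map_add, map_smul, map_smul, opDiag_bas, opDiag_bas, if_pos (e.2 h₁), tieCoeff]
      split_ifs with h₃ h₄
      · simp
      · refine (h₄ ?_).elim
        rw [← h₁, simpleTransposition, OrdSetPar.perm_swap _ ((tie x c a).2 h₃)]
      · simp
      · simp
    · rw [opDiag_bas, if_neg (mt e.1 h₁), zero_smul]
    · rw [map_add, map_smul, map_smul, opDiag_bas, opDiag_bas, if_neg (mt e.1 h₁), tieCoeff]
      split_ifs with h₃ h₄
      · refine (h₁ ?_).elim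
        rw [← OrdSetPar.perm_swap _ ((tie x c a).2 h₃), ← simpleTransposition, h₄,
          ← OrdSetPar.perm_mul, simpleTransposition_mul_self, OrdSetPar.perm_one]
      · simp
      · simp
      · simp
  · intro a A h
    refine hom_ext fun x c => ?_
    rw [Module.End.mul_apply, opDiag_bas, map_smul, LinearMap.smul_apply, opDiag_bas]
    split_ifs with h₁
    · rw [← h₁, tie] at h
      rw [sq, Module.End.mul_apply, one_smul, opG_opG_bas, tieCoeff, if_neg h, zero_smul, add_zero,
        one_smul]
    · simp
  · intro a A h
    refine hom_ext fun x c => ?_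
    rw [Module.End.mul_apply, Module.End.mul_apply, opDiag_bas, map_smul, map_smul]
    split_ifs with h₁
    · rw [← h₁, tie] at h
      rw [sq, Module.End.mul_apply, opG_opG_bas, tieCoeff, if_pos h, LinearMap.add_apply,
        Module.algebraMap_end_apply, LinearMap.smul_apply]
    · simp

/-- The linear map is evaluation of the module on the sum of all coloured identity words. There
`ē(A)` selects the colour `A`, and the normal form turns the identity word into a single other word.
-/
theorem exists_lift_word : ∃ L : OrdBT 𝕜 q n →ₗ[𝕜] Space 𝕜 n (OrdSetPar n),
    ∀ (k : ℕ), k < n → ∀ (u : NF k) (A : OrdSetPar n),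
      L (nf (natExt (g q)) k u * eBar q A) = bas (nf (sN n) k u)⁻¹ A := by
  obtain ⟨φ, hg, he⟩ := exists_rep (𝕜 := 𝕜) q (n := n)
  refine ⟨(LinearMap.applyₗ (∑ A : OrdSetPar n, bas 1 A)).comp φ.toLinearMap,
    fun k hk u A => ?_⟩
  have h₁ : φ (nf (natExt (g q)) k u) = nf (natExt (opG q OrdSetPar.toSetPar)) k u := by
    rw [← funext hg]
    exact map_nf_natExt (φ : OrdBT 𝕜 q n →* Module.End 𝕜 (Space 𝕜 n (OrdSetPar n))) _ k u
  have h₂ : φ (eBar q A) (∑ A : OrdSetPar n, bas 1 A) = bas 1 A := by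
    simp [he, opDiag_bas, OrdSetPar.perm_one]
  change φ (_ * _) _ = _
  rw [map_mul, Module.End.mul_apply, h₂, h₁, nf_opG_bas q _ k hk]

open Classical in
-- The identity as `π` gives the basis of the algebra; the underlying set partition as `π` gives the
-- injectivity of `ε₁`.
theorem linearIndependent_sum_nf {I : Type*} (π : OrdSetPar n → I)
    (hπ : Function.Surjective π) (k : ℕ) (hk : k < n) :
    LinearIndependent 𝕜 fun y : NF k × I => nf (natExt (g q)) k y.1 *
      ∑ A ∈ Finset.univ.filter (fun A => π A = y.2), eBar (𝕜 := 𝕜) q A := by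
  obtain ⟨L, hL⟩ := exists_lift_word (𝕜 := 𝕜) q (n := n)
  refine LinearIndependent.of_comp L ?_
  convert linearIndependent_sum_bas (𝕜 := 𝕜) π hπ k hk using 2 with y
  simp [Finset.mul_sum, hL _ hk]

theorem linearIndependent_nf (hn : 0 < n) :
    LinearIndependent 𝕜 fun y : NF (n - 1) × OrdSetPar n =>
      nf (natExt (g q)) (n - 1) y.1 * eBar (𝕜 := 𝕜) q y.2 := by
  simpa [Finset.sum_filter] using linearIndependent_sum_nf (𝕜 := 𝕜) q (id : OrdSetPar n → _)
    Function.surjective_id (n - 1) (by omega)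

/-- The basis of products of a normal form and an idempotent. -/
noncomputable def basis (hn : 0 < n) :
    Module.Basis (NF (n - 1) × OrdSetPar n) 𝕜 (OrdBT 𝕜 q n) :=
  Module.Basis.mk (linearIndependent_nf q hn) (span_nf q).ge

theorem finrank_eq (hn : 0 < n) :
    Module.finrank 𝕜 (OrdBT 𝕜 q n) = n.factorial * fubini n := by
  rw [Module.finrank_eq_card_basis (basis q hn), Fintype.card_prod, card_NF,
    Nat.sub_add_cancel hn, fubini]

end OrdBT

/-! ### Products of commuting projectors and roots of unity -/

section OrderedProducts

variable {R : Type*} [Ring R]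

theorem mul_ofFn_prod {𝕜 : Type*} [CommSemiring 𝕜] [Algebra 𝕜 R] {m : ℕ} (f : Fin m → R) (x : R)
    (c : 𝕜) (a : Fin m) (h : ∀ i, x * f i = f i * x) (ha : x * f a = c • f a) :
    x * (List.ofFn f).prod = c • (List.ofFn f).prod := by
  induction m with
  | zero => exact a.elim0
  | succ m ih =>
    rw [List.ofFn_succ, List.prod_cons]
    induction a using Fin.cases with
    | zero => rw [← mul_assoc, ha, smul_mul_assoc]
    | succ a =>
      rw [← mul_assoc, h, mul_assoc, ih (fun i => f i.succ) a (fun i => h _) ha, mul_smul_comm]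

theorem commute_ofFn_prod {m : ℕ} (f : Fin m → R) (x : R) (h : ∀ i, x * f i = f i * x) :
    x * (List.ofFn f).prod = (List.ofFn f).prod * x :=
  Commute.list_prod_right _ _ fun y hy => by
    obtain ⟨i, rfl⟩ := (List.mem_ofFn' f y).1 hy
    exact h i

theorem sum_ofFn_prod {m d : ℕ} (f : Fin m → Fin d → R) :
    ∑ j : Fin m → Fin d, (List.ofFn fun a => f a (j a)).prod =
      (List.ofFn fun a => ∑ p, f a p).prod := by
  induction m with
  | zero => simp
  | succ m ih =>
    rw [← (Fin.consEquiv fun _ : Fin (m + 1) => Fin d).sum_comp, Fintype.sum_prod_type,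
      List.ofFn_succ, List.prod_cons, ← ih, Finset.sum_mul_sum]
    refine Finset.sum_congr rfl fun p _ => Finset.sum_congr rfl fun j _ => ?_
    simp [List.ofFn_succ, Fin.consEquiv]

end OrderedProducts

section RootsOfUnity

variable {𝕜 : Type*} [Field 𝕜] {d : ℕ} {ξ : 𝕜}

theorem pow_succ_injective (hξ : IsPrimitiveRoot ξ d) {p r : Fin d}
    (h : ξ ^ ((p : ℕ) + 1) = ξ ^ ((r : ℕ) + 1)) : p = r := by
  have h₀ : ξ ≠ 0 := hξ.ne_zero (by have := p.2; omega)
  rw [pow_succ, pow_succ] at h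
  exact Fin.ext (hξ.pow_inj p.2 r.2 (mul_right_cancel₀ h₀ h))

open Classical in
-- Since `β ^ d = 1`, the exponent `d - r` stands for `-r`; this is a geometric sum with ratio `α /
-- β`, itself a `d`-th root of unity.
theorem sum_pow_mul_pow (α β : 𝕜) (hα : α ^ d = 1) (hβ : β ^ d = 1) (hd : d ≠ 0) :
    ∑ r ∈ range d, α ^ r * β ^ (d - r) = if α = β then (d : 𝕜) else 0 := by
  have h₀ : β ≠ 0 := fun h => by simp [h, hd] at hβ
  have e : ∀ r ∈ range d, α ^ r * β ^ (d - r) = (α / β) ^ r := by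
    intro r hr
    rw [div_pow, eq_div_iff (pow_ne_zero _ h₀), mul_assoc, ← pow_add,
      Nat.sub_add_cancel (Finset.mem_range.1 hr).le, hβ, mul_one]
  rw [Finset.sum_congr rfl e]
  split_ifs with h
  · simp [h, div_self h₀]
  · have h₁ : α / β - 1 ≠ 0 := fun h' => h (by rwa [sub_eq_zero, div_eq_one_iff_eq h₀] at h')
    have := mul_geom_sum (α / β) d
    rw [div_pow, hα, hβ, div_one, sub_self] at this
    exact (mul_eq_zero.1 this).resolve_left h₁

variable {R : Type*} [Ring R] [Algebra 𝕜 R]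

/-- The remainder of `P` modulo `X ^ d - 1` has degree below `d` and vanishes at `d` distinct
points, so it is zero. -/
theorem aeval_eq_zero_of_pow_eq_one (hξ : IsPrimitiveRoot ξ d) (hd : d ≠ 0) {t : R}
    (ht : t ^ d = 1) (P : Polynomial 𝕜) (hP : ∀ p : Fin d, P.eval (ξ ^ ((p : ℕ) + 1)) = 0) :
    Polynomial.aeval t P = 0 := by
  have hm : (Polynomial.X ^ d - 1 : Polynomial 𝕜).Monic := Polynomial.monic_X_pow_sub_C 1 hd
  have hr : ∀ p : Fin d, (ξ ^ ((p : ℕ) + 1)) ^ d = 1 := fun p => by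
    rw [← pow_mul, mul_comm, pow_mul, hξ.pow_eq_one, one_pow]
  have h₀ : P %ₘ (Polynomial.X ^ d - 1) = 0 := by
    refine Polynomial.eq_zero_of_degree_lt_of_eval_index_eq_zero (s := (Finset.univ : Finset (Fin d)))
      (v := fun p : Fin d => ξ ^ ((p : ℕ) + 1)) (fun p _ r _ h => pow_succ_injective hξ h) ?_ ?_
    · refine (Polynomial.degree_modByMonic_lt _ hm).trans_le ?_
      rw [Finset.card_univ, Fintype.card_fin]
      exact (Polynomial.degree_X_pow_sub_C (Nat.pos_of_ne_zero hd) (1 : 𝕜)).le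
    · intro p _
      have h := congrArg (Polynomial.eval (ξ ^ ((p : ℕ) + 1)))
        (Polynomial.modByMonic_add_div P (Polynomial.X ^ d - 1))
      simpa [hP, hr] using h
  rw [← Polynomial.modByMonic_add_div P (Polynomial.X ^ d - 1), h₀]
  simp [ht]

theorem mul_aeval_eq {x s t : R} (h : x * s = t * x) (P : Polynomial 𝕜) :
    x * Polynomial.aeval s P = Polynomial.aeval t P * x := by
  have h' : ∀ n : ℕ, x * s ^ n = t ^ n * x := by
    intro n
    induction n with
    | zero => simp
    | succ n ih => rw [pow_succ', ← mul_assoc, h, mul_assoc, ih, ← mul_assoc, ← pow_succ']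
  induction P using Polynomial.induction_on' with
  | add P Q hP hQ => rw [map_add, map_add, mul_add, add_mul, hP, hQ]
  | monomial n a =>
    rw [Polynomial.aeval_monomial, Polynomial.aeval_monomial, ← Algebra.smul_def,
      ← Algebra.smul_def, mul_smul_comm, h', smul_mul_assoc]

end RootsOfUnity

theorem pow_apply_of_apply_eq_smul {𝕜 M : Type*} [CommSemiring 𝕜] [AddCommMonoid M] [Module 𝕜 M]
    (U : Module.End 𝕜 M) (c : 𝕜) (y : M) (h : U y = c • y) (i : ℕ) : (U ^ i) y = c ^ i • y := by
  induction i with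
  | zero => simp
  | succ i ih => rw [pow_succ, Module.End.mul_apply, h, map_smul, ih, smul_smul, pow_succ']

/-! ### The Yokonuma-Hecke algebra: joint eigenprojectors and the embedding `ε` -/

namespace YokonumaHecke

open WordRep

variable {𝕜 : Type*} [Field 𝕜] (q : 𝕜) (d : ℕ) {n : ℕ}

theorem exists_lift {B : Type*} [Ring B] [Algebra 𝕜 B] (G : Fin (n - 1) → B)
    (T : Fin n → B) (t_pow : ∀ a, T a ^ d = 1) (t_comm : ∀ a b, T a * T b = T b * T a)
    (t_g : ∀ a b, T a * G b = G b * T (simpleTransposition b a))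
    (quadratic : ∀ a, G a ^ 2 = algebraMap 𝕜 B q + (q - 1) •
      (((d : 𝕜)⁻¹ • ∑ r ∈ range d, T (lo a) ^ r * T (hi a) ^ (d - r)) * G a))
    (braid : ∀ a b, Near a b → G a * G b * G a = G b * G a * G b)
    (far : ∀ a b, Far a b → G a * G b = G b * G a) :
    ∃ φ : YokonumaHecke 𝕜 q d n →ₐ[𝕜] B, (∀ a, φ (g q d a) = G a) ∧ ∀ a, φ (t q d a) = T a := by
  let F : YGen n → B := fun x => match x with
    | .g a => G a
    | .t a => T a
  have hF : ∀ x y, YGen.Rel 𝕜 q d x y → FreeAlgebra.lift 𝕜 F x = FreeAlgebra.lift 𝕜 F y := by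
    intro x y h
    induction h with
    | t_pow a => simpa [F] using t_pow a
    | t_comm a b => simpa [F] using t_comm a b
    | t_g a b => simpa [F] using t_g a b
    | quadratic a =>
      simpa only [F, YGen.E, map_mul, map_pow, map_add, map_smul, map_sum, AlgHom.commutes,
        FreeAlgebra.lift_ι_apply] using quadratic a
    | braid a b h => simpa [F] using braid a b h
    | far a b h => simpa [F] using far a b h
  refine ⟨RingQuot.liftAlgHom 𝕜 ⟨FreeAlgebra.lift 𝕜 F, fun ⦃x y⦄ => hF x y⟩, fun a => ?_,
    fun A => ?_⟩
  · rw [g, RingQuot.liftAlgHom_mkAlgHom_apply, FreeAlgebra.lift_ι_apply]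
  · rw [t, RingQuot.liftAlgHom_mkAlgHom_apply, FreeAlgebra.lift_ι_apply]

theorem t_pow (a : Fin n) : t (𝕜 := 𝕜) q d a ^ d = 1 := by
  simpa [t] using RingQuot.mkAlgHom_rel 𝕜 (YGen.Rel.t_pow (𝕜 := 𝕜) (q := q) (d := d) a)

theorem t_comm (a b : Fin n) : t (𝕜 := 𝕜) q d a * t q d b = t q d b * t q d a := by
  simpa [t] using RingQuot.mkAlgHom_rel 𝕜 (YGen.Rel.t_comm (𝕜 := 𝕜) (q := q) (d := d) a b)

theorem t_mul_g (a : Fin n) (b : Fin (n - 1)) :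
    t (𝕜 := 𝕜) q d a * g q d b = g q d b * t q d (simpleTransposition b a) := by
  simpa [t, g] using RingQuot.mkAlgHom_rel 𝕜 (YGen.Rel.t_g (𝕜 := 𝕜) (q := q) (d := d) a b)

/-- The idempotent `e_a` of the Yokonuma-Hecke algebra. -/
noncomputable def e (a : Fin (n - 1)) : YokonumaHecke 𝕜 q d n :=
  (d : 𝕜)⁻¹ • ∑ r ∈ range d, t q d (lo a) ^ r * t q d (hi a) ^ (d - r)

theorem g_sq (a : Fin (n - 1)) :
    g (𝕜 := 𝕜) q d a ^ 2 = algebraMap 𝕜 _ q + (q - 1) • (e q d a * g q d a) := by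
  have := RingQuot.mkAlgHom_rel 𝕜 (YGen.Rel.quadratic (𝕜 := 𝕜) (q := q) (d := d) a)
  simpa only [e, t, g, YGen.E, map_mul, map_pow, map_add, map_smul, map_sum, AlgHom.commutes]
    using this

theorem braid (a b : Fin (n - 1)) (h : Near a b) :
    g (𝕜 := 𝕜) q d a * g q d b * g q d a = g q d b * g q d a * g q d b := by
  simpa [g] using RingQuot.mkAlgHom_rel 𝕜 (YGen.Rel.braid (𝕜 := 𝕜) (q := q) (d := d) a b h)

theorem far (a b : Fin (n - 1)) (h : Far a b) :
    g (𝕜 := 𝕜) q d a * g q d b = g q d b * g q d a := by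
  simpa [g] using RingQuot.mkAlgHom_rel 𝕜 (YGen.Rel.far (𝕜 := 𝕜) (q := q) (d := d) a b h)

variable {d} {ξ : 𝕜} (hξ : IsPrimitiveRoot ξ d) (hd : (d : 𝕜) ≠ 0)

theorem t_mul_proj_comm (a b : Fin n) (p : Fin d) :
    t q d a * proj q d ξ b p = proj q d ξ b p * t q d a :=
  mul_aeval_eq (t_comm q d a b) _

include hξ hd

/-- The polynomial `X - ξ ^ (p + 1)` times the Lagrange polynomial at `p` vanishes at all the roots
of unity, so it kills `t a`. -/
theorem t_mul_proj (a : Fin n) (p : Fin d) :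
    t q d a * proj q d ξ a p = ξ ^ ((p : ℕ) + 1) • proj q d ξ a p := by
  have h := aeval_eq_zero_of_pow_eq_one hξ (fun h => hd (by simp [h])) (t_pow q d a)
    ((Polynomial.X - Polynomial.C (ξ ^ ((p : ℕ) + 1))) *
      Lagrange.basis Finset.univ (fun r : Fin d => ξ ^ ((r : ℕ) + 1)) p) (fun r => by
        rcases eq_or_ne p r with rfl | hpr
        · simp
        · rw [Polynomial.eval_mul, Lagrange.eval_basis_of_ne (v := fun r : Fin d =>
            ξ ^ ((r : ℕ) + 1)) hpr (Finset.mem_univ _), mul_zero])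
  rw [map_mul, map_sub, Polynomial.aeval_X, Polynomial.aeval_C, sub_mul, sub_eq_zero,
    ← Algebra.smul_def] at h
  exact h

theorem sum_proj (a : Fin n) : ∑ p, proj q d ξ a p = 1 := by
  have h₀ : d ≠ 0 := fun h => hd (by simp [h])
  have : NeZero d := ⟨h₀⟩
  unfold proj
  rw [← map_sum, Lagrange.sum_basis (fun p _ r _ h => pow_succ_injective hξ h)
    Finset.univ_nonempty, map_one]

theorem t_mul_eJ (a : Fin n) (j : Fin n → Fin d) :
    t q d a * eJ q d ξ j = ξ ^ ((j a : ℕ) + 1) • eJ q d ξ j :=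
  mul_ofFn_prod _ _ _ a (fun i => t_mul_proj_comm q a i _) (t_mul_proj q hξ hd a (j a))

theorem eJ_mul_t (a : Fin n) (j : Fin n → Fin d) :
    eJ q d ξ j * t q d a = ξ ^ ((j a : ℕ) + 1) • eJ q d ξ j := by
  rw [← t_mul_eJ q hξ hd]
  exact (commute_ofFn_prod _ _ fun i => t_mul_proj_comm q a i _).symm

theorem sum_eJ : ∑ j : Fin n → Fin d, eJ q d ξ j = 1 := by
  unfold eJ
  rw [sum_ofFn_prod fun a p => proj q d ξ a p]
  simp [sum_proj q hξ hd]

/-- On a joint eigenvector of the `t a`, exactly one of the idempotents `e(𝐣)` acts as `1` and the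
others act as `0`. -/
theorem map_eJ_eigenvector {M : Type*} [AddCommGroup M] [Module 𝕜 M]
    (φ : YokonumaHecke 𝕜 q d n →ₐ[𝕜] Module.End 𝕜 M) (y : M) (i : Fin n → Fin d)
    (h : ∀ a, φ (t q d a) y = ξ ^ ((i a : ℕ) + 1) • y) (j : Fin n → Fin d) :
    φ (eJ q d ξ j) y = if j = i then y else 0 := by
  have h₀ : ∀ j, j ≠ i → φ (eJ q d ξ j) y = 0 := by
    intro j hj
    obtain ⟨a, ha⟩ := Function.ne_iff.1 hj
    have h₁ := congrArg (fun z => φ z y) (eJ_mul_t q hξ hd a j)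
    simp only [map_mul, Module.End.mul_apply, h, map_smul, LinearMap.smul_apply] at h₁
    rw [← sub_eq_zero, ← sub_smul, smul_eq_zero] at h₁
    exact h₁.resolve_left fun h₂ => ha (pow_succ_injective hξ (sub_eq_zero.1 h₂)).symm
  split_ifs with hj
  · subst hj
    have h₁ := congrArg (fun z => φ z y) (sum_eJ q hξ hd (n := n))
    simp only [map_sum, LinearMap.sum_apply, map_one, Module.End.one_apply] at h₁
    rwa [Finset.sum_eq_single j (fun k _ hk => h₀ k hk) (by simp)] at h₁
  · exact h₀ j hj

theorem eJ_mul_eigenvector (y : YokonumaHecke 𝕜 q d n) (i : Fin n → Fin d)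
    (h : ∀ a, t q d a * y = ξ ^ ((i a : ℕ) + 1) • y) (j : Fin n → Fin d) :
    eJ q d ξ j * y = if j = i then y else 0 :=
  map_eJ_eigenvector q hξ hd (Algebra.lmul 𝕜 _) y i h j

theorem eq_of_mul_eJ {x y : YokonumaHecke 𝕜 q d n}
    (h : ∀ j, x * eJ q d ξ j = y * eJ q d ξ j) : x = y := by
  rw [← mul_one x, ← mul_one y, ← sum_eJ q hξ hd, Finset.mul_sum, Finset.mul_sum]
  exact Finset.sum_congr rfl fun j _ => h j

/-- By the relation between `t` and `g`, the element `g b * e(𝐢)` is a joint eigenvector with the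
entries of `𝐢` at `b` and `b + 1` exchanged. Applying this to every `𝐢` identifies both sides after
right multiplication by each projector. -/
theorem g_mul_eJ (b : Fin (n - 1)) (j : Fin n → Fin d) :
    g q d b * eJ q d ξ j = eJ q d ξ (j ∘ simpleTransposition b) * g q d b := by
  have h₁ : ∀ i : Fin n → Fin d, ∀ k, eJ q d ξ k * (g q d b * eJ q d ξ i) =
      if k = i ∘ simpleTransposition b then g q d b * eJ q d ξ i else 0 := by
    intro i k
    refine eJ_mul_eigenvector q hξ hd _ _ (fun a => ?_) k
    rw [← mul_assoc, t_mul_g, mul_assoc, t_mul_eJ q hξ hd, mul_smul_comm]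
    rfl
  refine eq_of_mul_eJ q hξ hd fun k => ?_
  rw [mul_assoc, mul_assoc, h₁,
    eJ_mul_eigenvector q hξ hd _ k (fun a => t_mul_eJ q hξ hd a k) j]
  have : j ∘ simpleTransposition b = k ∘ simpleTransposition b ↔ j = k :=
    (simpleTransposition b).surjective.injective_comp_right.eq_iff
  simp only [this]
  split_ifs with h
  · rfl
  · rw [mul_zero]

/-- Powers of two operators with common eigenvectors. -/
theorem sum_pow_mul_pow_apply {M : Type*} [AddCommGroup M] [Module 𝕜 M] (S T : Module.End 𝕜 M)
    (y : M) (p r : Fin d) (hS : S y = ξ ^ ((p : ℕ) + 1) • y) (hT : T y = ξ ^ ((r : ℕ) + 1) • y) :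
    ((d : 𝕜)⁻¹ • ∑ i ∈ range d, S ^ i * T ^ (d - i)) y = if p = r then y else 0 := by
  have hr : ∀ p : Fin d, (ξ ^ ((p : ℕ) + 1)) ^ d = 1 := fun p => by
    rw [← pow_mul, mul_comm, pow_mul, hξ.pow_eq_one, one_pow]
  have e : ∀ i ∈ range d, (S ^ i * T ^ (d - i)) y =
      ((ξ ^ ((p : ℕ) + 1)) ^ i * (ξ ^ ((r : ℕ) + 1)) ^ (d - i)) • y := by
    intro i _
    rw [Module.End.mul_apply, pow_apply_of_apply_eq_smul T _ _ hT, map_smul,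
      pow_apply_of_apply_eq_smul S _ _ hS, smul_smul, mul_comm]
  rw [LinearMap.smul_apply, LinearMap.sum_apply, Finset.sum_congr rfl e, ← Finset.sum_smul,
    sum_pow_mul_pow _ _ (hr p) (hr r) (fun h => hd (by simp [h])), smul_smul]
  by_cases hpr : p = r
  · simp [hpr, hd]
  · rw [if_neg fun h => hpr (pow_succ_injective hξ h), if_neg hpr, mul_zero, zero_smul]

theorem e_mul_eJ (a : Fin (n - 1)) (j : Fin n → Fin d) :
    e q d a * eJ q d ξ j = if j (lo a) = j (hi a) then eJ q d ξ j else 0 := by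
  have := sum_pow_mul_pow_apply hξ hd (Algebra.lmul 𝕜 _ (t q d (lo a)))
    (Algebra.lmul 𝕜 _ (t q d (hi a))) (eJ q d ξ j) _ _ (t_mul_eJ q hξ hd _ _)
    (t_mul_eJ q hξ hd _ _)
  rw [← this]
  simp only [← map_pow, ← map_mul, ← map_sum, ← map_smul]
  rfl

theorem eBar_mul_eJ (A : OrdSetPar n) (j : Fin n → Fin d) :
    eBar q d ξ A * eJ q d ξ j = if OrdSetPar.ofFun j = A then eJ q d ξ j else 0 := by
  unfold eBar
  rw [Finset.sum_mul, Finset.sum_congr rfl fun k _ =>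
    eJ_mul_eigenvector q hξ hd _ j (fun a => t_mul_eJ q hξ hd a j) k]
  simp [Finset.sum_ite_eq']

/-- On each `e(𝐣)` the element `ē(A)` acts as `1` or `0`, according to whether the fibres of `𝐣`
give `A`. Each relation that involves idempotents is tested there. -/
theorem exists_ordBT_hom : ∃ ε : OrdBT 𝕜 q n →ₐ[𝕜] YokonumaHecke 𝕜 q d n,
    (∀ a, ε (OrdBT.g q a) = g q d a) ∧ ∀ A, ε (OrdBT.eBar q A) = eBar q d ξ A := by
  have hperm : ∀ (a : Fin (n - 1)) (j : Fin n → Fin d),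
      OrdSetPar.ofFun (j ∘ simpleTransposition a) =
        (OrdSetPar.ofFun j).perm (simpleTransposition a) := fun a j => by
    rw [OrdSetPar.ofFun_perm, simpleTransposition_inv]
  -- Moving `e(𝐣)` to the left of `g a` exchanges its entries at `a` and `a + 1`; the condition for
  -- `e a` to act as `1`, their equality, is unaffected.
  have hq : ∀ (a : Fin (n - 1)) (j : Fin n → Fin d), g q d a ^ 2 * eJ q d ξ j =
      q • eJ q d ξ j + if j (lo a) = j (hi a) then (q - 1) • (g q d a * eJ q d ξ j) else 0 := by
    intro a j
    rw [g_sq, add_mul, ← Algebra.smul_def, smul_mul_assoc, mul_assoc, g_mul_eJ q hξ hd, ← mul_assoc,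
      e_mul_eJ q hξ hd]
    simp only [Function.comp, simpleTransposition_lo, simpleTransposition_hi, eq_comm (a := j (hi a))]
    split_ifs <;> simp
  refine OrdBT.exists_lift q (g q d) (eBar q d ξ) ?_ ?_ ?_ ?_ ?_ (braid q d) (far q d)
  · unfold eBar
    rw [Finset.sum_fiberwise, sum_eJ q hξ hd]
  · intro A B
    refine eq_of_mul_eJ q hξ hd fun j => ?_
    rw [mul_assoc, eBar_mul_eJ q hξ hd]
    split_ifs with h₁ h₂ h₂
    · rw [h₂]
    · rw [eBar_mul_eJ q hξ hd, if_neg fun h => h₂ (h.symm.trans h₁), zero_mul]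
    · rw [mul_zero, eBar_mul_eJ q hξ hd, if_neg fun h => h₁ (h.trans h₂)]
    · simp
  · intro a A
    refine eq_of_mul_eJ q hξ hd fun j => ?_
    rw [mul_assoc, mul_assoc, g_mul_eJ q hξ hd, ← mul_assoc (eBar _ _ _ _), eBar_mul_eJ q hξ hd,
      eBar_mul_eJ q hξ hd, hperm]
    simp only [OrdSetPar.perm_inj]
    split_ifs with h
    · rw [g_mul_eJ q hξ hd]
    · simp
  · intro a A h
    refine eq_of_mul_eJ q hξ hd fun j => ?_
    rw [mul_assoc, smul_mul_assoc, eBar_mul_eJ q hξ hd]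
    split_ifs with h₁
    · rw [← h₁, OrdSetPar.ofFun_toSetPar] at h
      rw [hq, if_neg h, add_zero]
    · simp
  · intro a A h
    refine eq_of_mul_eJ q hξ hd fun j => ?_
    rw [mul_assoc, mul_assoc, eBar_mul_eJ q hξ hd]
    split_ifs with h₁
    · rw [← h₁, OrdSetPar.ofFun_toSetPar] at h
      rw [hq, if_pos h, add_mul, ← Algebra.smul_def, smul_mul_assoc]
    · simp

/-- The colours belong to the letters: `t a` reads the colour of the letter at position `a`, and
letters are tied when their colours agree. -/
theorem exists_rep : ∃ φ : YokonumaHecke 𝕜 q d n →ₐ[𝕜] Module.End 𝕜 (Space 𝕜 n (Fin n → Fin d)),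
    (∀ a, φ (g q d a) = opG q Setoid.ker a) ∧
    ∀ a, φ (t q d a) = opDiag fun x c => ξ ^ ((c (x a) : ℕ) + 1) := by
  refine exists_lift q d (opG q Setoid.ker)
    (fun a => opDiag fun x (c : Fin n → Fin d) => ξ ^ ((c (x a) : ℕ) + 1))
    ?_ ?_ ?_ ?_ (fun a b => opG_braid q _) (fun a b => opG_far q _)
  · intro a
    refine hom_ext fun x c => ?_
    rw [pow_apply_of_apply_eq_smul _ _ _ (opDiag_bas _ x c), ← pow_mul, mul_comm, pow_mul,
      hξ.pow_eq_one, one_pow, one_smul, Module.End.one_apply]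
  · intro a b
    refine hom_ext fun x c => ?_
    simp only [Module.End.mul_apply, opDiag_bas, map_smul]
    rw [smul_comm]
  · intro a b
    refine hom_ext fun x c => ?_
    rw [Module.End.mul_apply, Module.End.mul_apply, opDiag_bas, map_smul, opG_bas]
    split_ifs with h
    · rw [opDiag_bas, Equiv.Perm.mul_apply]
    · rw [map_add, map_smul, map_smul, opDiag_bas, opDiag_bas, Equiv.Perm.mul_apply, smul_add,
        smul_comm q, tieCoeff]
      congr 1
      split_ifs with h'
      · have h' : c (x (lo b)) = c (x (hi b)) := h'
        have : c (x (simpleTransposition b a)) = c (x a) := by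
          unfold simpleTransposition
          rcases eq_or_ne a (lo b) with rfl | h₁
          · rw [Equiv.swap_apply_left, h']
          rcases eq_or_ne a (hi b) with rfl | h₂
          · rw [Equiv.swap_apply_right, h']
          rw [Equiv.swap_apply_of_ne_of_ne h₁ h₂]
        rw [this, smul_comm]
      · simp
  · intro a
    refine hom_ext fun x c => ?_
    have key : ∀ x : Equiv.Perm (Fin n),
        ((d : 𝕜)⁻¹ • ∑ r ∈ range d,
          (opDiag fun x (c : Fin n → Fin d) => ξ ^ ((c (x (lo a)) : ℕ) + 1)) ^ r *
          (opDiag fun x (c : Fin n → Fin d) => ξ ^ ((c (x (hi a)) : ℕ) + 1)) ^ (d - r))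
            (bas x c : Space 𝕜 n (Fin n → Fin d)) =
          if c (x (lo a)) = c (x (hi a)) then bas x c else 0 :=
      fun x => sum_pow_mul_pow_apply hξ hd _ _ _ _ _ (opDiag_bas _ x c) (opDiag_bas _ x c)
    generalize ((d : 𝕜)⁻¹ • ∑ r ∈ range d,
      (opDiag fun x (c : Fin n → Fin d) => ξ ^ ((c (x (lo a)) : ℕ) + 1)) ^ r *
      (opDiag fun x (c : Fin n → Fin d) => ξ ^ ((c (x (hi a)) : ℕ) + 1)) ^ (d - r) :
        Module.End 𝕜 (Space 𝕜 n (Fin n → Fin d))) = E at key ⊢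
    rw [sq, Module.End.mul_apply, opG_opG_bas, LinearMap.add_apply, Module.algebraMap_end_apply,
      LinearMap.smul_apply, Module.End.mul_apply]
    congr 1
    have h₁ : tieCoeff q Setoid.ker c (x (lo a)) (x (hi a)) =
        if c (x (lo a)) = c (x (hi a)) then q - 1 else 0 := by
      simp [tieCoeff, Setoid.ker_def]
    rw [h₁, opG_bas, h₁]
    split_ifs with h₂ h₃ h₃ <;>
      simp [key, simpleTransposition_lo, simpleTransposition_hi, h₂,
        eq_comm (a := c (x (hi a)))]

theorem exists_lift_word : ∃ L : YokonumaHecke 𝕜 q d n →ₗ[𝕜] Space 𝕜 n (Fin n → Fin d),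
    ∀ (k : ℕ), k < n → ∀ (u : NF k) (j : Fin n → Fin d),
      L (nf (natExt (g q d)) k u * eJ q d ξ j) = bas (nf (sN n) k u)⁻¹ j := by
  obtain ⟨φ, hg, ht⟩ := exists_rep q hξ hd (n := n)
  refine ⟨(LinearMap.applyₗ (∑ j : Fin n → Fin d, bas 1 j)).comp φ.toLinearMap,
    fun k hk u j => ?_⟩
  have h₁ : φ (nf (natExt (g q d)) k u) = nf (natExt (opG q Setoid.ker)) k u := by
    rw [← funext hg]
    exact map_nf_natExt
      (φ : YokonumaHecke 𝕜 q d n →* Module.End 𝕜 (Space 𝕜 n (Fin n → Fin d))) _ k u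
  have h₂ : φ (eJ q d ξ j) (∑ j : Fin n → Fin d, bas 1 j) = bas 1 j := by
    rw [map_sum, Finset.sum_congr rfl fun i _ => map_eJ_eigenvector q hξ hd φ (bas 1 i) i
      (fun a => by rw [ht, opDiag_bas]; rfl) j]
    simp
  change φ (_ * _) _ = _
  rw [map_mul, Module.End.mul_apply, h₂, h₁, nf_opG_bas q _ k hk]

/-- The image of `ē(A)` is the sum of the `e(𝐣)` over the fibre of `OrdSetPar.ofFun` above `A`. No
fibre is empty because `n ≤ d`, so the spanning family stays independent after evaluation in the
module. -/
theorem ordBT_hom_injective (hn : 0 < n) (hnd : n ≤ d)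
    (ε : OrdBT 𝕜 q n →ₐ[𝕜] YokonumaHecke 𝕜 q d n)
    (hg : ∀ a, ε (OrdBT.g q a) = g q d a) (he : ∀ A, ε (OrdBT.eBar q A) = eBar q d ξ A) :
    Function.Injective ε := by
  obtain ⟨L, hL⟩ := exists_lift_word q hξ hd (n := n)
  refine injective_of_span_of_linearIndependent ε.toLinearMap _ (OrdBT.span_nf q) ?_
  refine LinearIndependent.of_comp L ?_
  convert linearIndependent_sum_bas (𝕜 := 𝕜) (n := n) (OrdSetPar.ofFun (n := n) (d := d))
    (OrdSetPar.exists_ofFun_eq hnd) (n - 1) (by omega) using 1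
  funext y
  have h₁ : ε (nf (natExt (OrdBT.g q)) (n - 1) y.1) = nf (natExt (g q d)) (n - 1) y.1 := by
    rw [← funext hg]
    exact map_nf_natExt (ε : OrdBT 𝕜 q n →* YokonumaHecke 𝕜 q d n) _ _ _
  simp only [Function.comp, AlgHom.toLinearMap_apply, map_mul, h₁, he, eBar, Finset.mul_sum,
    map_sum]
  exact Finset.sum_congr (by congr) fun j _ => hL (n - 1) (by omega) _ _

end YokonumaHecke

/-! ### Ties under the action of the braid group -/

/-- The relations between braid generators that act on a set and the elements `e a`. -/
structure IsTieAction {Γ X : Type*} [Group Γ] [MulAction Γ X] (c : ℕ → Γ) (e : ℕ → X)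
    (N : ℕ) : Prop where
  braid : ∀ a, a + 1 < N → c a * c (a + 1) * c a = c (a + 1) * c a * c (a + 1)
  far : ∀ a b, a + 1 < b → b < N → c a * c b = c b * c a
  self : ∀ a < N, c a • e a = e a
  far_left : ∀ a b, a + 1 < b → b < N → c a • e b = e b
  far_right : ∀ a b, a + 1 < b → b < N → c b • e a = e a
  near : ∀ a, a + 1 < N → c a • c (a + 1) • e a = e (a + 1)
  sq : ∀ a < N, ∀ b < N, c b • c b • e a = e a

/-- The tie between the positions `i` and `i + k + 1`. -/
def tieN {Γ X : Type*} [SMul Γ X] (c : ℕ → Γ) (e : ℕ → X) (i : ℕ) : ℕ → X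
  | 0 => e i
  | k + 1 => c (i + k + 1) • tieN c e i k

/-- The tie between the positions `i` and `j`. -/
def tieP {Γ X : Type*} [SMul Γ X] [One X] (c : ℕ → Γ) (e : ℕ → X) (i j : ℕ) : X :=
  if i < j then tieN c e i (j - i - 1) else if j < i then tieN c e j (i - j - 1) else 1

namespace IsTieAction

variable {Γ X : Type*} [Group Γ] [MulAction Γ X] {c : ℕ → Γ} {e : ℕ → X} {N : ℕ}
  (h : IsTieAction c e N)

include h

theorem far_smul (a b : ℕ) (hab : a + 1 < b ∨ b + 1 < a) (ha : a < N) (hb : b < N) (x : X) :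
    c a • c b • x = c b • c a • x := by
  rcases hab with hab | hab
  · rw [smul_smul, h.far a b hab hb, mul_smul]
  · rw [smul_smul, ← h.far b a hab ha, mul_smul]

theorem smul_tieN_low (b i k : ℕ) (hb : b + 1 < i) (hk : i + k < N) :
    c b • tieN c e i k = tieN c e i k := by
  induction k with
  | zero => exact h.far_left b i hb hk
  | succ k ih =>
    rw [tieN, h.far_smul b _ (by omega) (by omega) (by omega), ih (by omega)]

theorem smul_tieN_high (b i k : ℕ) (hb : i + k + 1 < b) (hN : b < N) :
    c b • tieN c e i k = tieN c e i k := by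
  induction k with
  | zero => exact h.far_right i b hb hN
  | succ k ih =>
    rw [tieN, h.far_smul b _ (by omega) (by omega) (by omega), ih (by omega)]

/-- The essential case has `b` just below the last generator used. With `T` the shorter tie, the
braid relation gives `c b • c (b + 1) • c b • T = c (b + 1) • c b • c (b + 1) • T`, and `c (b + 1)`
fixes `T`. -/
theorem smul_tieN_mid (b i k : ℕ) (hi : i < b) (hb : b < i + k) (hN : i + k < N) :
    c b • tieN c e i k = tieN c e i k := by
  induction k with
  | zero => omega
  | succ k ih =>
    rcases (show b < i + k ∨ b = i + k by omega) with hb' | rfl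
    · rw [tieN, h.far_smul b _ (by omega) (by omega) (by omega), ih hb' (by omega)]
    · obtain ⟨k, rfl⟩ : ∃ m, k = m + 1 := ⟨k - 1, by omega⟩
      rw [tieN, tieN]
      have e₁ := h.braid (i + k + 1) (by omega)
      have e₂ := h.smul_tieN_high (i + k + 1 + 1) i k (by omega) (by omega)
      have e₃ := congrArg (fun γ => γ • tieN c e i k) e₁
      simp only [mul_smul, e₂] at e₃
      exact e₃

/-- The shortest case is the axiom `near`; for longer ties `c i` commutes with the generators that
moved the right end further. -/
theorem smul_tieN_raise (i k : ℕ) (hN : i + k + 1 < N) :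
    c i • tieN c e i (k + 1) = tieN c e (i + 1) k := by
  induction k with
  | zero => exact h.near i hN
  | succ k ih =>
    rw [tieN, h.far_smul i _ (by omega) (by omega) (by omega), ih (by omega), tieN]
    congr 2
    omega

/-- Raising the left end by `c i`, which commutes with the top generator, reduces to a shorter tie,
and finally to the axiom `sq`. This makes moving an end back the same as undoing the move. -/
theorem sq_tieN_top (i k : ℕ) (hN : i + k + 1 < N) :
    c (i + k + 1) • c (i + k + 1) • tieN c e i k = tieN c e i k := by
  induction k generalizing i with
  | zero => exact h.sq i (by omega) _ hN
  | succ k ih =>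
    have e₁ := h.smul_tieN_raise i k (by omega)
    have e₂ := ih (i + 1) (by omega)
    rw [show i + 1 + k + 1 = i + (k + 1) + 1 by omega, ← e₁,
      ← h.far_smul i _ (by omega) (by omega) (by omega),
      ← h.far_smul i _ (by omega) (by omega) (by omega)] at e₂
    exact smul_left_cancel _ e₂

theorem sq_tieN_bot (i k : ℕ) (hN : i + k + 1 < N) :
    c i • c i • tieN c e i (k + 1) = tieN c e i (k + 1) := by
  induction k with
  | zero =>
    have e₁ : c i • tieN c e i 1 = e (i + 1) := h.smul_tieN_raise i 0 hN
    have e₂ := h.sq (i + 1) hN i (by omega)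
    rw [← e₁] at e₂
    exact smul_left_cancel _ e₂
  | succ k ih =>
    rw [tieN, h.far_smul i (i + (k + 1) + 1) (by omega) (by omega) (by omega),
      h.far_smul i (i + (k + 1) + 1) (by omega) (by omega) (by omega), ih (by omega)]

theorem smul_tieN_lower (i k : ℕ) (hN : i + k + 1 < N) :
    c i • tieN c e (i + 1) k = tieN c e i (k + 1) := by
  rw [← h.smul_tieN_raise i k hN, h.sq_tieN_bot i k hN]

end IsTieAction

theorem tieP_comm {Γ X : Type*} [SMul Γ X] [One X] (c : ℕ → Γ) (e : ℕ → X) (i j : ℕ) :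
    tieP c e i j = tieP c e j i := by
  unfold tieP
  rcases lt_trichotomy i j with h | rfl | h
  · simp [h, h.not_gt]
  · rfl
  · simp [h, h.not_gt]

theorem tieP_self {Γ X : Type*} [SMul Γ X] [One X] (c : ℕ → Γ) (e : ℕ → X) (i : ℕ) :
    tieP c e i i = 1 := by
  simp [tieP]

theorem tieP_of_eq {Γ X : Type*} [SMul Γ X] [One X] (c : ℕ → Γ) (e : ℕ → X) {i j k : ℕ}
    (h : j = i + k + 1) : tieP c e i j = tieN c e i k := by
  subst h
  rw [tieP, if_pos (by omega)]
  congr 1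
  omega

/-- The cases are the positions of `b`, `b + 1` relative to the ends of the tie: away from both ends
nothing changes, while touching one end shifts that end by one. If `b` and `b + 1` are both ends,
the tie is `e b` itself. -/
theorem IsTieAction.smul_tieP {Γ X : Type*} [Group Γ] [Monoid X] [MulDistribMulAction Γ X]
    {c : ℕ → Γ} {e : ℕ → X} {N : ℕ} (h : IsTieAction c e N) (b : ℕ) (hb : b < N) (i j : ℕ)
    (hi : i ≤ N) (hj : j ≤ N) :
    c b • tieP c e i j = tieP c e (Equiv.swap b (b + 1) i) (Equiv.swap b (b + 1) j) := by
  wlog hij : i ≤ j generalizing i j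
  · rw [tieP_comm, this j i hj hi (by omega), tieP_comm]
  rcases hij.eq_or_lt with rfl | hij
  · rw [tieP_self, tieP_self, smul_one]
  obtain ⟨k, rfl⟩ := Nat.exists_eq_add_of_lt hij
  have sw : ∀ x, x ≠ b → x ≠ b + 1 → Equiv.swap b (b + 1) x = x :=
    fun x => Equiv.swap_apply_of_ne_of_ne
  rw [tieP_of_eq c e rfl]
  rcases lt_trichotomy (b + 1) i with h₁ | rfl | h₁
  · rw [sw i (by omega) (by omega), sw _ (by omega) (by omega), tieP_of_eq c e rfl,
      h.smul_tieN_low b i k h₁ (by omega)]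
  · rw [Equiv.swap_apply_right, sw _ (by omega) (by omega),
      tieP_of_eq c e (show b + 1 + k + 1 = b + (k + 1) + 1 by omega),
      h.smul_tieN_lower b k (by omega)]
  rcases (show i = b ∨ i < b by omega) with rfl | h₂
  · rw [Equiv.swap_apply_left]
    cases k with
    | zero =>
      rw [Equiv.swap_apply_right, tieP_comm, tieP_of_eq c e (k := 0) (by omega)]
      exact h.self i hb
    | succ k =>
      rw [sw _ (by omega) (by omega),
        tieP_of_eq c e (show i + (k + 1) + 1 = i + 1 + k + 1 by omega),
        h.smul_tieN_raise i k (by omega)]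
  rw [sw i (by omega) (by omega)]
  rcases lt_trichotomy b (i + k) with h₃ | rfl | h₃
  · rw [sw _ (by omega) (by omega), tieP_of_eq c e rfl, h.smul_tieN_mid b i k h₂ h₃ (by omega)]
  · obtain ⟨k, rfl⟩ : ∃ m, k = m + 1 := ⟨k - 1, by omega⟩
    rw [Equiv.swap_apply_right, tieP_of_eq c e (show i + (k + 1) = i + k + 1 by omega), tieN]
    exact h.sq_tieN_top i k (by omega)
  rcases (show b = i + k + 1 ∨ i + k + 1 < b by omega) with rfl | h₄
  · rw [Equiv.swap_apply_left, tieP_of_eq c e (show i + k + 1 + 1 = i + (k + 1) + 1 by omega), tieN]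
  · rw [sw _ (by omega) (by omega), tieP_of_eq c e rfl, h.smul_tieN_high b i k h₄ hb]

/-! ### The bt-algebra: conjugation and identities between ties -/

namespace BT

variable {𝕜 : Type*} [Field 𝕜] (q : 𝕜) {n : ℕ}

theorem exists_lift {B : Type*} [Ring B] [Algebra 𝕜 B] (G E : Fin (n - 1) → B)
    (g_e : ∀ a, G a * E a = E a * G a)
    (braid : ∀ a b, Near a b → G a * G b * G a = G b * G a * G b)
    (far : ∀ a b, Far a b → G a * G b = G b * G a)
    (e_g_g : ∀ a b, Near a b → E a * G b * G a = G b * G a * E b)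
    (e_e_g : ∀ a b, Near a b → E a * E b * G b = E a * G b * E a)
    (e_g_e : ∀ a b, Near a b → E a * G b * E a = G b * E a * E b)
    (e_comm : ∀ a b, E a * E b = E b * E a)
    (g_e_far : ∀ a b, Far a b → G a * E b = E b * G a)
    (e_sq : ∀ a, E a ^ 2 = E a)
    (quadratic : ∀ a, G a ^ 2 = algebraMap 𝕜 B q + (q - 1) • (E a * G a)) :
    ∃ φ : BT 𝕜 q n →ₐ[𝕜] B, (∀ a, φ (g q a) = G a) ∧ ∀ a, φ (e q a) = E a := by
  let F : BTGen n → B := fun x => match x with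
    | .g a => G a
    | .e a => E a
  have hF : ∀ x y, BTGen.Rel 𝕜 q x y → FreeAlgebra.lift 𝕜 F x = FreeAlgebra.lift 𝕜 F y := by
    intro x y h
    induction h with
    | g_e a => simpa [F] using g_e a
    | braid a b h => simpa [F] using braid a b h
    | far a b h => simpa [F] using far a b h
    | e_g_g a b h => simpa [F] using e_g_g a b h
    | e_e_g a b h => simpa [F] using e_e_g a b h
    | e_g_e a b h => simpa [F] using e_g_e a b h
    | e_comm a b => simpa [F] using e_comm a b
    | g_e_far a b h => simpa [F] using g_e_far a b h
    | e_sq a => simpa [F] using e_sq a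
    | quadratic a =>
      simpa only [F, map_mul, map_pow, map_add, map_smul, AlgHom.commutes,
        FreeAlgebra.lift_ι_apply] using quadratic a
  refine ⟨RingQuot.liftAlgHom 𝕜 ⟨FreeAlgebra.lift 𝕜 F, fun ⦃x y⦄ => hF x y⟩, fun a => ?_,
    fun A => ?_⟩
  · rw [g, RingQuot.liftAlgHom_mkAlgHom_apply, FreeAlgebra.lift_ι_apply]
  · rw [e, RingQuot.liftAlgHom_mkAlgHom_apply, FreeAlgebra.lift_ι_apply]

theorem g_mul_e (a : Fin (n - 1)) : g q a * e q a = e q a * g q a := by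
  simpa [g, e] using RingQuot.mkAlgHom_rel 𝕜 (BTGen.Rel.g_e (𝕜 := 𝕜) (q := q) a)

theorem braid (a b : Fin (n - 1)) (h : Near a b) :
    g q a * g q b * g q a = g q b * g q a * g q b := by
  simpa [g] using RingQuot.mkAlgHom_rel 𝕜 (BTGen.Rel.braid (𝕜 := 𝕜) (q := q) a b h)

theorem far (a b : Fin (n - 1)) (h : Far a b) : g q a * g q b = g q b * g q a := by
  simpa [g] using RingQuot.mkAlgHom_rel 𝕜 (BTGen.Rel.far (𝕜 := 𝕜) (q := q) a b h)

theorem e_g_g (a b : Fin (n - 1)) (h : Near a b) :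
    e q a * g q b * g q a = g q b * g q a * e q b := by
  simpa [g, e] using RingQuot.mkAlgHom_rel 𝕜 (BTGen.Rel.e_g_g (𝕜 := 𝕜) (q := q) a b h)

theorem e_e_g (a b : Fin (n - 1)) (h : Near a b) :
    e q a * e q b * g q b = e q a * g q b * e q a := by
  simpa [g, e] using RingQuot.mkAlgHom_rel 𝕜 (BTGen.Rel.e_e_g (𝕜 := 𝕜) (q := q) a b h)

theorem e_g_e (a b : Fin (n - 1)) (h : Near a b) :
    e q a * g q b * e q a = g q b * e q a * e q b := by
  simpa [g, e] using RingQuot.mkAlgHom_rel 𝕜 (BTGen.Rel.e_g_e (𝕜 := 𝕜) (q := q) a b h)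

theorem e_comm (a b : Fin (n - 1)) : e q a * e q b = e q b * e q a := by
  simpa [e] using RingQuot.mkAlgHom_rel 𝕜 (BTGen.Rel.e_comm (𝕜 := 𝕜) (q := q) a b)

theorem g_e_far (a b : Fin (n - 1)) (h : Far a b) : g q a * e q b = e q b * g q a := by
  simpa [g, e] using RingQuot.mkAlgHom_rel 𝕜 (BTGen.Rel.g_e_far (𝕜 := 𝕜) (q := q) a b h)

theorem e_mul_self (a : Fin (n - 1)) : e q a * e q a = e q a := by
  simpa [e, sq] using RingQuot.mkAlgHom_rel 𝕜 (BTGen.Rel.e_sq (𝕜 := 𝕜) (q := q) a)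

theorem g_mul_self (a : Fin (n - 1)) :
    g q a * g q a = algebraMap 𝕜 _ q + (q - 1) • (e q a * g q a) := by
  have := RingQuot.mkAlgHom_rel 𝕜 (BTGen.Rel.quadratic (𝕜 := 𝕜) (q := q) a)
  simpa only [e, g, sq, map_mul, map_add, map_smul, AlgHom.commutes] using this

variable {q}

theorem g_mul_gInv (hq : q ≠ 0) (a : Fin (n - 1)) : g q a * gInv q a = 1 := by
  rw [gInv, mul_add, mul_smul_comm, mul_smul_comm, g_mul_self, g_mul_e,
    Algebra.algebraMap_eq_smul_one]
  match_scalars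
  · field_simp
  · field_simp
    ring

theorem gInv_mul_g (hq : q ≠ 0) (a : Fin (n - 1)) : gInv q a * g q a = 1 := by
  rw [← g_mul_gInv hq a, gInv, mul_add, add_mul, mul_smul_comm, mul_smul_comm, smul_mul_assoc,
    smul_mul_assoc, g_mul_e]

/-- The unit `g a`. -/
noncomputable def unit (hq : q ≠ 0) (a : Fin (n - 1)) : (BT 𝕜 q n)ˣ :=
  ⟨g q a, gInv q a, g_mul_gInv hq a, gInv_mul_g hq a⟩

/-- Conjugation by `g a`. -/
noncomputable def conj (hq : q ≠ 0) (a : Fin (n - 1)) : ConjAct (BT 𝕜 q n)ˣ :=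
  ConjAct.toConjAct (unit hq a)

theorem conj_smul (hq : q ≠ 0) (a : Fin (n - 1)) (x : BT 𝕜 q n) :
    conj hq a • x = g q a * x * gInv q a := rfl

theorem conj_smul_eq_iff (hq : q ≠ 0) (a : Fin (n - 1)) (x y : BT 𝕜 q n) :
    conj hq a • x = y ↔ g q a * x = y * g q a := by
  rw [conj_smul]
  constructor
  · rintro rfl
    rw [mul_assoc _ _ (g q a), gInv_mul_g hq, mul_one]
  · intro h
    rw [h, mul_assoc, g_mul_gInv hq, mul_one]

theorem g_mul_e_mul_e (a b : Fin (n - 1)) (h : Near a b) :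
    g q b * (e q a * e q b) = e q a * e q b * g q b := by
  rw [e_e_g q a b h, e_g_e q a b h, mul_assoc]

/-- The square of `g b` is a scalar plus a multiple of `e b * g b`, and the latter commutes with `e
a`; for neighbours this holds because `g b` commutes with `e a * e b`. -/
theorem conj_sq (hq : q ≠ 0) (a b : Fin (n - 1)) : conj hq b • conj hq b • e q a = e q a := by
  have key : e q b * g q b * e q a = e q a * (e q b * g q b) := by
    rcases lt_trichotomy ((a : ℕ) + 1) b with h | h | h
    · rw [mul_assoc, g_e_far q b a (Or.inr h), ← mul_assoc, e_comm, mul_assoc]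
    · rw [← mul_assoc, ← g_mul_e_mul_e a b (Or.inl h), e_comm q a b, ← g_mul_e]
      simp only [mul_assoc]
    · rcases (show (a : ℕ) = b ∨ (b : ℕ) + 1 = a ∨ (b : ℕ) + 1 < a by omega) with h | h | h
      · obtain rfl : a = b := Fin.ext h
        rw [mul_assoc, g_mul_e]
      · rw [← mul_assoc, ← g_mul_e_mul_e a b (Or.inr h), e_comm q a b, ← g_mul_e]
        simp only [mul_assoc]
      · rw [mul_assoc, g_e_far q b a (Or.inl h), ← mul_assoc, e_comm, mul_assoc]
  have h₂ : g q b * g q b * e q a = e q a * (g q b * g q b) := by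
    rw [g_mul_self, add_mul, mul_add, smul_mul_assoc, mul_smul_comm, key, Algebra.commutes]
  rw [conj_smul, conj_smul]
  calc _ = g q b * g q b * e q a * gInv q b * gInv q b := by simp only [mul_assoc]
    _ = e q a * (g q b * (g q b * gInv q b) * gInv q b) := by rw [h₂]; simp only [mul_assoc]
    _ = e q a := by rw [g_mul_gInv hq, mul_one, g_mul_gInv hq, mul_one]

theorem conj_near (hq : q ≠ 0) (a b : Fin (n - 1)) (h : Near a b) :
    conj hq b • conj hq a • e q b = e q a := by
  rw [conj_smul_eq_iff, conj_smul]
  calc _ = g q b * g q a * e q b * gInv q a := by simp only [mul_assoc]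
    _ = e q a * g q b * (g q a * gInv q a) := by rw [← e_g_g q a b h]; simp only [mul_assoc]
    _ = _ := by rw [g_mul_gInv hq, mul_one]

theorem isTieAction (hq : q ≠ 0) :
    IsTieAction (natExt (conj hq (n := n))) (natExt (e q (n := n))) (n - 1) where
  braid a h := by
    rw [natExt_of_lt _ h, natExt_of_lt _ (show a < n - 1 by omega)]
    have : unit hq ⟨a, by omega⟩ * unit hq ⟨a + 1, h⟩ * unit hq ⟨a, by omega⟩ =
        unit hq ⟨a + 1, h⟩ * unit hq ⟨a, by omega⟩ * unit hq ⟨a + 1, h⟩ :=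
      Units.ext (braid q _ _ (Or.inl rfl))
    exact this
  far a b h h' := by
    rw [natExt_of_lt _ h', natExt_of_lt _ (show a < n - 1 by omega)]
    have : unit hq ⟨a, by omega⟩ * unit hq ⟨b, h'⟩ = unit hq ⟨b, h'⟩ * unit hq ⟨a, by omega⟩ :=
      Units.ext (far q _ _ (Or.inl h))
    exact this
  self a h := by
    rw [natExt_of_lt _ h, natExt_of_lt _ h, conj_smul_eq_iff]
    exact g_mul_e q _
  far_left a b h h' := by
    rw [natExt_of_lt _ h', natExt_of_lt _ (show a < n - 1 by omega), conj_smul_eq_iff]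
    exact g_e_far q _ _ (Or.inl h)
  far_right a b h h' := by
    rw [natExt_of_lt _ h', natExt_of_lt _ (show a < n - 1 by omega), conj_smul_eq_iff]
    exact g_e_far q _ _ (Or.inr h)
  near a h := by
    rw [natExt_of_lt _ h, natExt_of_lt _ h, natExt_of_lt _ (show a < n - 1 by omega),
      natExt_of_lt _ (show a < n - 1 by omega)]
    exact conj_near hq _ _ (Or.inr rfl)
  sq a h b h' := by
    rw [natExt_of_lt _ h, natExt_of_lt _ h']
    exact conj_sq hq _ _

theorem tieAux_eq (hq : q ≠ 0) (a k : ℕ) (h : a + k + 1 < n) :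
    tieAux q a k h = tieN (natExt (conj hq (n := n))) (natExt (e q (n := n))) a k := by
  induction k with
  | zero => rw [tieAux, tieN, natExt_of_lt _ (show a < n - 1 by omega)]
  | succ k ih =>
    rw [tieAux, tieN, natExt_of_lt _ (show a + k + 1 < n - 1 by omega), conj_smul, ih]

theorem tie_eq (hq : q ≠ 0) (i j : Fin n) :
    tie q i j = tieP (natExt (conj hq (n := n))) (natExt (e q (n := n))) i j := by
  unfold tie tieP
  simp only [Fin.lt_def]
  split_ifs
  · exact tieAux_eq hq _ _ _
  · exact tieAux_eq hq _ _ _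
  · rfl

theorem tie_comm (hq : q ≠ 0) (i j : Fin n) : tie q i j = tie q j i := by
  rw [tie_eq hq, tie_eq hq, tieP_comm]

theorem tie_self (i : Fin n) : tie q i i = 1 := by
  simp [tie]

theorem tie_lo_hi (a : Fin (n - 1)) : tie q (lo a) (hi a) = e q a := by
  have : lo a < hi a := by simp [lo, hi, Fin.lt_def]
  rw [tie, dif_pos this]
  have e₁ : ∀ m (h : (lo a : ℕ) + m + 1 < n), m = 0 → tieAux q (lo a) m h = e q a := by
    rintro m h rfl
    rfl
  exact e₁ _ _ (by simp [lo, hi])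

theorem val_simpleTransposition (a : Fin (n - 1)) (i : Fin n) :
    ((simpleTransposition a i : Fin n) : ℕ) = Equiv.swap (a : ℕ) (a + 1) i := by
  simp only [simpleTransposition, Equiv.swap_apply_def, Fin.ext_iff, lo, hi]
  split_ifs <;> rfl

theorem conj_smul_tie (hq : q ≠ 0) (a : Fin (n - 1)) (i j : Fin n) :
    conj hq a • tie q i j = tie q (simpleTransposition a i) (simpleTransposition a j) := by
  have := (isTieAction hq (n := n)).smul_tieP a a.2 i j (by omega) (by omega)
  rw [natExt_of_lt _ a.2] at this
  rw [tie_eq hq, tie_eq hq, val_simpleTransposition, val_simpleTransposition, ← this]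

theorem closure_simpleTransposition :
    Submonoid.closure (Set.range (simpleTransposition (n := n))) = ⊤ := by
  cases n with
  | zero => exact Subsingleton.elim _ _
  | succ n => exact Equiv.Perm.mclosure_swap_castSucc_succ n

theorem exists_smul_tie (hq : q ≠ 0) (σ : Equiv.Perm (Fin n)) :
    ∃ γ : ConjAct (BT 𝕜 q n)ˣ, ∀ i j, γ • tie q i j = tie q (σ i) (σ j) := by
  have hσ : σ ∈ Submonoid.closure (Set.range (simpleTransposition (n := n))) := by
    rw [closure_simpleTransposition]
    trivial
  induction hσ using Submonoid.closure_induction with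
  | mem σ hσ =>
    obtain ⟨a, rfl⟩ := hσ
    exact ⟨conj hq a, conj_smul_tie hq a⟩
  | one => exact ⟨1, fun i j => by simp⟩
  | mul σ τ _ _ hσ hτ =>
    obtain ⟨γ, h₁⟩ := hσ
    obtain ⟨γ', h₂⟩ := hτ
    exact ⟨γ * γ', fun i j => by rw [mul_smul, h₂, h₁]; rfl⟩

theorem exists_perm_pair {α : Type*} [DecidableEq α] {a b i j : α} (hab : a ≠ b) (hij : i ≠ j) :
    ∃ σ : Equiv.Perm α, σ a = i ∧ σ b = j := by
  -- The inner swap sends `b` to the preimage of `j` under the outer one, and fixes `a` because `a ≠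
  -- b` and `i ≠ j`.
  refine ⟨Equiv.swap a i * Equiv.swap b (Equiv.swap a i j), ?_, ?_⟩
  · rw [Equiv.Perm.mul_apply, Equiv.swap_apply_of_ne_of_ne hab, Equiv.swap_apply_left]
    intro h
    rw [← Equiv.swap_apply_eq_iff, Equiv.swap_apply_left] at h
    exact hij h
  · rw [Equiv.Perm.mul_apply, Equiv.swap_apply_left, Equiv.swap_apply_self]

/-- Every tie is a conjugate of the tie of the first two positions. -/
theorem exists_tie_eq_smul (hq : q ≠ 0) (hn : 1 < n) {i j : Fin n} (hij : i ≠ j) :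
    ∃ (γ : ConjAct (BT 𝕜 q n)ˣ) (σ : Equiv.Perm (Fin n)), σ i = ⟨0, by omega⟩ ∧ σ j = ⟨1, hn⟩ ∧
      tie q i j = γ • e q ⟨0, by omega⟩ ∧ ∀ k l, tie q k l = γ • tie q (σ k) (σ l) := by
  obtain ⟨σ, h₁, h₂⟩ := exists_perm_pair hij (show (⟨0, by omega⟩ : Fin n) ≠ ⟨1, hn⟩ by simp)
  obtain ⟨γ, hγ⟩ := exists_smul_tie hq σ⁻¹
  have h : ∀ k l, tie q k l = γ • tie q (σ k) (σ l) := fun k l => by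
    rw [hγ]
    simp
  refine ⟨γ, σ, h₁, h₂, ?_, h⟩
  rw [h, h₁, h₂, ← tie_lo_hi]
  rfl

theorem commute_smul {Γ X : Type*} [Group Γ] [Monoid X] [MulDistribMulAction Γ X] {γ : Γ}
    {x y : X} (h : Commute x y) : Commute (γ • x) (γ • y) := by
  rw [Commute, SemiconjBy, ← smul_mul', h.eq, smul_mul']

/-- Extending a tie to the right conjugates by a generator that fixes `e 0`, except in the step from
the tie `0, 1` to the tie `0, 2`. Ties starting at `0` are therefore obtained from those starting at
`1`, by conjugation with generator `0`, which fixes `e 0` as well. -/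
theorem commute_e_zero_tieN (hq : q ≠ 0) (k m : ℕ) (hN : k + m < n - 1) :
    Commute (natExt (e q (n := n)) 0) (tieN (natExt (conj hq (n := n))) (natExt (e q (n := n))) k m) := by
  have hT := isTieAction hq (n := n)
  have step : ∀ k m, k + m + 1 < n - 1 → 1 ≤ k + m → Commute (natExt (e q (n := n)) 0)
      (tieN (natExt (conj hq (n := n))) (natExt (e q (n := n))) k m) → Commute (natExt (e q (n := n)) 0)
      (tieN (natExt (conj hq (n := n))) (natExt (e q (n := n))) k (m + 1)) := by
    intro k m hN h₁ h
    rw [tieN, ← hT.far_right 0 (k + m + 1) (by omega) hN]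
    exact commute_smul h
  have base : ∀ k, k < n - 1 → Commute (natExt (e q (n := n)) 0) (natExt (e q (n := n)) k) := by
    intro k hk
    rw [natExt_of_lt _ hk, natExt_of_lt _ (show 0 < n - 1 by omega)]
    exact e_comm q _ _
  have pos : ∀ m k, k + 1 + m < n - 1 → Commute (natExt (e q (n := n)) 0)
      (tieN (natExt (conj hq (n := n))) (natExt (e q (n := n))) (k + 1) m) := by
    intro m
    induction m with
    | zero => exact fun k hk => base (k + 1) (by omega)
    | succ m ih => exact fun k hk => step _ _ (by omega) (by omega) (ih k (by omega))
  cases k with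
  | succ k => exact pos m k hN
  | zero =>
    cases m with
    | zero => exact base 0 (by omega)
    | succ m =>
      rw [← hT.smul_tieN_lower 0 m (by omega)]
      have := commute_smul (γ := natExt (conj hq (n := n)) 0) (pos m 0 (by omega))
      rwa [hT.self 0 (by omega)] at this

theorem commute_e_zero_tie (hq : q ≠ 0) (hn : 1 < n) (k l : Fin n) :
    Commute (e q ⟨0, by omega⟩) (tie q k l) := by
  have h : ∀ k l : Fin n, k < l → Commute (e q ⟨0, by omega⟩) (tie q k l) := by
    intro k l h
    rw [tie, dif_pos h, tieAux_eq hq]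
    have := commute_e_zero_tieN hq k (l - k - 1) (n := n) (by omega)
    rwa [natExt_of_lt _ (show 0 < n - 1 by omega)] at this
  rcases lt_trichotomy k l with hkl | rfl | hkl
  · exact h k l hkl
  · rw [tie_self]
    exact Commute.one_right _
  · rw [tie_comm hq]
    exact h l k hkl

theorem commute_tie (hq : q ≠ 0) (i j k l : Fin n) : Commute (tie q i j) (tie q k l) := by
  rcases eq_or_ne i j with rfl | hij
  · rw [tie_self]
    exact Commute.one_left _
  have hn : 1 < n := by
    by_contra hn
    exact hij (Fin.ext (by omega))
  obtain ⟨γ, σ, -, -, h₁, h₂⟩ := exists_tie_eq_smul hq hn hij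
  rw [h₁, h₂ k l]
  exact commute_smul (commute_e_zero_tie hq hn _ _)

theorem tie_mul_self (hq : q ≠ 0) (i j : Fin n) : tie q i j * tie q i j = tie q i j := by
  rcases eq_or_ne i j with rfl | hij
  · rw [tie_self, mul_one]
  have hn : 1 < n := by
    by_contra hn
    exact hij (Fin.ext (by omega))
  obtain ⟨γ, σ, -, -, h₁, -⟩ := exists_tie_eq_smul hq hn hij
  rw [h₁, ← smul_mul', e_mul_self]

/-- For the nearest third position this is `e_a e_b g_b = e_a g_b e_a` with `g_b` cancelled.
Conjugation by further generators, which fix `e 0`, moves that position to the right. -/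
theorem e_zero_mul_tieN (hq : q ≠ 0) (m : ℕ) (hN : m + 1 < n - 1) :
    natExt (e q (n := n)) 0 * tieN (natExt (conj hq (n := n))) (natExt (e q (n := n))) 1 m =
      natExt (e q (n := n)) 0 * tieN (natExt (conj hq (n := n))) (natExt (e q (n := n))) 0 (m + 1) := by
  induction m with
  | zero =>
    simp only [tieN]
    rw [natExt_of_lt _ (show 0 + 0 + 1 < n - 1 by omega), natExt_of_lt _ (show 1 < n - 1 by omega),
      natExt_of_lt _ (show 0 < n - 1 by omega), conj_smul, ← mul_assoc, ← mul_assoc,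
      ← e_e_g q _ _ (Or.inl rfl), mul_assoc, g_mul_gInv hq, mul_one]
  | succ m ih =>
    have := congrArg (fun x => natExt (conj hq (n := n)) (m + 2) • x) (ih (by omega))
    simp only [smul_mul', (isTieAction hq (n := n)).far_right 0 (m + 2) (by omega) (by omega)] at this
    rw [tieN, tieN, show 1 + m + 1 = m + 2 by omega, show 0 + (m + 1) + 1 = m + 2 by omega, this]

/-- This identity makes the relation "absorbs the tie of `k` and `l`" transitive. Conjugation moves
`i`, `j` to the first two positions, where `e_zero_mul_tieN` applies. -/
theorem tie_mul_tie (hq : q ≠ 0) (i j k : Fin n) :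
    tie q i j * tie q j k = tie q i j * tie q i k := by
  rcases eq_or_ne i j with rfl | hij
  · rfl
  rcases eq_or_ne j k with rfl | hjk
  · rw [tie_self, mul_one, tie_mul_self hq]
  rcases eq_or_ne i k with rfl | hik
  · rw [tie_comm hq j i, tie_self, mul_one, tie_mul_self hq]
  have hn : 1 < n := by
    by_contra hn
    exact hij (Fin.ext (by omega))
  obtain ⟨γ, σ, hi, hj, h₁, h₂⟩ := exists_tie_eq_smul hq hn hij
  rw [h₁, h₂ j k, h₂ i k, ← smul_mul', ← smul_mul', hi, hj]
  congr 1
  have hk₀ : σ k ≠ ⟨0, by omega⟩ := fun h => hik (σ.injective (hi.trans h.symm))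
  have hk₁ : σ k ≠ ⟨1, hn⟩ := fun h => hjk (σ.injective (hj.trans h.symm))
  generalize σ k = k at *
  have hk : 1 < (k : ℕ) := by
    by_contra hk
    rcases (show (k : ℕ) = 0 ∨ (k : ℕ) = 1 by omega) with h | h
    · exact hk₀ (Fin.ext h)
    · exact hk₁ (Fin.ext h)
  obtain ⟨m, hm⟩ := Nat.exists_eq_add_of_lt hk
  have := e_zero_mul_tieN hq m (n := n) (by omega)
  rw [natExt_of_lt _ (show 0 < n - 1 by omega)] at this
  rw [tie_eq hq, tie_eq hq, tieP_of_eq _ _ hm,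
    tieP_of_eq (k := m + 1) _ _ (show (k : ℕ) = 0 + (m + 1) + 1 by omega), this]

/-! ### The span of the `e(A)` -/

theorem mul_list_prod_of_absorb {M : Type*} [Monoid M] (x : M) (l : List M)
    (h : ∀ y ∈ l, x * y = x) : x * l.prod = x := by
  induction l with
  | nil => simp
  | cons y l ih =>
    rw [List.prod_cons, ← mul_assoc, h y (by simp), ih fun z hz => h z (by simp [hz])]

theorem list_prod_mul_of_mem {M : Type*} [Monoid M] (l : List M) (y : M) (hy : y ∈ l)
    (h : ∀ z ∈ l, Commute y z) (hyy : y * y = y) : l.prod * y = l.prod := by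
  induction l with
  | nil => simp at hy
  | cons z l ih =>
    rw [List.prod_cons]
    rcases List.mem_cons.1 hy with rfl | hy
    · have : Commute y l.prod := Commute.list_prod_right _ _ fun z hz => h z (by simp [hz])
      rw [mul_assoc, ← this.eq, ← mul_assoc, hyy]
    · rw [mul_assoc, ih hy fun w hw => h w (by simp [hw])]

theorem mul_eA_of_absorb (x : BT 𝕜 q n) (A : SetPar n) (h : ∀ i j, A i j → x * tie q i j = x) :
    x * eA q A = x := by
  classical
  refine mul_list_prod_of_absorb x _ fun y hy => ?_
  obtain ⟨p, hp, rfl⟩ := List.mem_map.1 hy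
  exact h _ _ (by simpa using (List.mem_filter.1 hp).2)

theorem commute_eA_of_commute (x : BT 𝕜 q n) (A : SetPar n) (h : ∀ i j, Commute x (tie q i j)) :
    Commute x (eA q A) := by
  classical
  refine Commute.list_prod_right _ _ fun y hy => ?_
  obtain ⟨p, hp, rfl⟩ := List.mem_map.1 hy
  exact h _ _

theorem commute_tie_eA (hq : q ≠ 0) (i j : Fin n) (A : SetPar n) :
    Commute (tie q i j) (eA q A) := commute_eA_of_commute _ A (commute_tie hq i j)

theorem eA_mul_tie (hq : q ≠ 0) (A : SetPar n) {i j : Fin n} (h : A i j) :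
    eA q A * tie q i j = eA q A := by
  classical
  refine list_prod_mul_of_mem _ _ (List.mem_map.2 ⟨(i, j), ?_, rfl⟩) ?_ (tie_mul_self hq i j)
  · simpa using h
  · intro y hy
    obtain ⟨p, hp, rfl⟩ := List.mem_map.1 hy
    exact commute_tie hq _ _ _ _

/-- Two commuting elements that absorb each other are equal, so the order and the repetitions in the
product defining `eA` never matter. -/
theorem tie_mul_eA (hq : q ≠ 0) (i j : Fin n) (A : SetPar n) :
    ∃ B, tie q i j * eA q A = eA q B := by
  set x := tie q i j * eA q A with hx
  -- The ties absorbed by `x` form an equivalence relation. It contains `A` and the pair `i, j`,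
  -- hence also `B`, the finest set partition above `A` that ties `i` and `j`.
  let r : SetPar n :=
    { r := fun k l => x * tie q k l = x
      iseqv :=
        { refl := fun k => by rw [tie_self, mul_one]
          symm := fun {k l} h => by rwa [tie_comm hq]
          trans := fun {k l m} h h' => by
            have : x * tie q k l * tie q l m = x := by rw [h, h']
            rwa [mul_assoc, tie_mul_tie hq, ← mul_assoc, h] at this } }
  let B : SetPar n := sInf {C | A ≤ C ∧ C i j}
  have hAB : A ≤ B := le_sInf fun C hC => hC.1
  have hB : B i j := fun C hC => hC.2
  have hr : B ≤ r := by
    refine sInf_le ⟨fun {k l} h => ?_, ?_⟩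
    · change x * tie q k l = x
      rw [hx, mul_assoc, eA_mul_tie hq A h]
    · change x * tie q i j = x
      rw [hx, mul_assoc, ← (commute_tie_eA hq i j A).eq, ← mul_assoc, tie_mul_self hq]
  refine ⟨B, ?_⟩
  have h₁ : x * eA q B = x := mul_eA_of_absorb x B fun k l h => hr h
  have h₂ : eA q B * x = eA q B := by
    rw [hx, ← mul_assoc, eA_mul_tie hq B hB]
    exact mul_eA_of_absorb _ A fun k l h => eA_mul_tie hq B (hAB h)
  have h₃ : Commute x (eA q B) := commute_eA_of_commute x B fun k l =>
    (commute_tie hq i j k l).mul_left (commute_tie_eA hq k l A).symm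
  rw [← h₁, h₃.eq, h₂]

theorem eA_mul_eA (hq : q ≠ 0) (A B : SetPar n) : ∃ C, eA q A * eA q B = eA q C := by
  have key : ∀ l : List (Fin n × Fin n), ∃ C, (l.map fun x => tie q x.1 x.2).prod * eA q B =
      eA q C := by
    intro l
    induction l with
    | nil => exact ⟨B, by simp⟩
    | cons p l ih =>
      obtain ⟨C, hC⟩ := ih
      obtain ⟨C', hC'⟩ := tie_mul_eA hq p.1 p.2 C
      exact ⟨C', by rw [List.map_cons, List.prod_cons, mul_assoc, hC, hC']⟩
  exact key _

theorem eA_bot : eA q (⊥ : SetPar n) = 1 := by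
  classical
  refine List.prod_eq_one fun y hy => ?_
  obtain ⟨p, hp, rfl⟩ := List.mem_map.1 hy
  have : p.1 = p.2 := by simpa using (List.mem_filter.1 hp).2
  rw [this, tie_self]

/-- Again by mutual absorption: conjugation carries the ties absorbed by one side to those absorbed
by the other. -/
theorem conj_smul_eA (hq : q ≠ 0) (a : Fin (n - 1)) (A : SetPar n) :
    conj hq a • eA q A = eA q (A.comap (simpleTransposition a)) := by
  set B : SetPar n := A.comap (simpleTransposition a) with hB
  have hBA : ∀ i j, B i j ↔ A (simpleTransposition a i) (simpleTransposition a j) :=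
    fun i j => Iff.rfl
  have ht : ∀ i j, tie q i j =
      conj hq a • tie q (simpleTransposition a i) (simpleTransposition a j) := fun i j => by
    rw [conj_smul_tie, simpleTransposition_apply_apply, simpleTransposition_apply_apply]
  have h₁ : conj hq a • eA q A * eA q B = conj hq a • eA q A :=
    mul_eA_of_absorb _ B fun i j h => by
      rw [ht, ← smul_mul', eA_mul_tie hq A ((hBA i j).1 h)]
  have h₂ : eA q B * conj hq a • eA q A = eA q B := by
    have : (conj hq a)⁻¹ • eA q B * eA q A = (conj hq a)⁻¹ • eA q B := by
      refine mul_eA_of_absorb _ A fun i j h => ?_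
      have h' : tie q i j =
          (conj hq a)⁻¹ • tie q (simpleTransposition a i) (simpleTransposition a j) := by
        rw [← conj_smul_tie hq, inv_smul_smul]
      rw [h', ← smul_mul', eA_mul_tie hq B]
      rw [hBA, simpleTransposition_apply_apply, simpleTransposition_apply_apply]
      exact h
    have := congrArg (fun x => conj hq a • x) this
    simpa only [smul_mul', smul_inv_smul] using this
  have h₃ : Commute (conj hq a • eA q A) (eA q B) := commute_eA_of_commute _ B fun i j => by
    rw [ht]
    exact commute_smul (commute_tie_eA hq _ _ A).symm
  rw [← h₁, h₃.eq, h₂]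

theorem isHeckeBase (hq : q ≠ 0) :
    IsHeckeBase (natExt (g (𝕜 := 𝕜) q (n := n))) (n - 1)
      (Submodule.span 𝕜 (Set.range (eA (𝕜 := 𝕜) q (n := n)))) := by
  have hmem : ∀ A, eA q A ∈ Submodule.span 𝕜 (Set.range (eA (𝕜 := 𝕜) q (n := n))) :=
    fun A => Submodule.subset_span ⟨A, rfl⟩
  have hone : (1 : BT 𝕜 q n) ∈ Submodule.span 𝕜 (Set.range (eA (𝕜 := 𝕜) q (n := n))) := by
    rw [← eA_bot]
    exact hmem _
  refine isHeckeBase_span _ (isBraidFamily_natExt _ (braid q) (far q)) hone ?_ ?_ ?_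
  · intro A B
    obtain ⟨C, hC⟩ := eA_mul_eA hq A B
    rw [hC]
    exact hmem C
  · intro a ha A
    refine ⟨A.comap (simpleTransposition ⟨a, ha⟩), ?_⟩
    rw [natExt_of_lt _ ha]
    symm
    rw [← conj_smul_eq_iff hq, conj_smul_eA hq]
    congr 1
    ext i j
    simp [Setoid.comap_rel, simpleTransposition_apply_apply]
  · intro a ha
    refine ⟨algebraMap 𝕜 _ q, ?_, (q - 1) • e q ⟨a, ha⟩, ?_, ?_⟩
    · rw [Algebra.algebraMap_eq_smul_one]
      exact Submodule.smul_mem _ _ hone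
    · refine Submodule.smul_mem _ _ ?_
      obtain ⟨B, hB⟩ := tie_mul_eA hq (lo ⟨a, ha⟩) (hi ⟨a, ha⟩) ⊥
      rw [eA_bot, mul_one, tie_lo_hi] at hB
      rw [hB]
      exact hmem B
    · rw [natExt_of_lt _ ha, g_mul_self, mul_smul_comm, g_mul_e]

/-- Each family is a combination of the other, by the definition of `ē` and by `sum_eBar`. -/
theorem span_eBar : Submodule.span 𝕜 (Set.range (eBar (𝕜 := 𝕜) q (n := n))) =
    Submodule.span 𝕜 (Set.range (eA (𝕜 := 𝕜) q (n := n))) := by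
  apply le_antisymm
  · refine Submodule.span_le.2 ?_
    rintro _ ⟨A, rfl⟩
    exact Submodule.sum_mem _ fun B _ => Submodule.smul_mem _ _ (Submodule.subset_span ⟨B, rfl⟩)
  · refine Submodule.span_le.2 ?_
    rintro _ ⟨A, rfl⟩
    rw [← sum_eBar]
    exact Submodule.sum_mem _ fun B _ => Submodule.subset_span ⟨B, rfl⟩

theorem span_nf (hq : q ≠ 0) :
    Submodule.span 𝕜 (Set.range fun y : NF (n - 1) × SetPar n =>
      nf (natExt (g q)) (n - 1) y.1 * eBar (𝕜 := 𝕜) q y.2) = ⊤ := by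
  have hD := isHeckeBase (𝕜 := 𝕜) hq (n := n)
  rw [← nfSpan_span, span_eBar]
  refine eq_top_of_generators_mul_mem (RingQuot.mkAlgHom 𝕜 (BTGen.Rel 𝕜 q))
    (RingQuot.mkAlgHom_surjective 𝕜 _) _ (hD.one_mem_nfSpan _) ?_
  rintro (a | a) z hz
  · have := hD.g_mul_mem (n - 1) le_rfl a a.2 z hz
    rwa [natExt_of_lt _ a.2] at this
  · refine hD.base_mul_mem (n - 1) le_rfl _ ?_ z hz
    obtain ⟨B, hB⟩ := tie_mul_eA hq (lo a) (hi a) ⊥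
    rw [eA_bot, mul_one, tie_lo_hi] at hB
    exact Submodule.subset_span ⟨B, hB.symm⟩

end BT

/-! ### Ties inside the ordered bt-algebra -/

namespace OrdBT

variable {𝕜 : Type*} [Field 𝕜] (q : 𝕜) {n : ℕ}

open Classical in
theorem tieIdem_mul_eBar (i j : Fin n) (A : OrdSetPar n) :
    tieIdem q i j * eBar q A = if A.toSetPar i j then eBar q A else 0 :=
  sum_filter_mul_eBar q _ A

theorem tieIdem_symm (i j : Fin n) : tieIdem (𝕜 := 𝕜) q i j = tieIdem q j i := by
  classical
  unfold tieIdem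
  exact Finset.sum_congr (Finset.filter_congr fun A _ => A.toSetPar.comm') fun _ _ => rfl

theorem tieIdem_self (i : Fin n) : tieIdem (𝕜 := 𝕜) q i i = 1 := by
  refine eq_of_mul_eBar q fun A => ?_
  rw [tieIdem_mul_eBar, if_pos (A.toSetPar.refl' i), one_mul]

theorem tieIdem_commute (i j k l : Fin n) :
    tieIdem (𝕜 := 𝕜) q i j * tieIdem q k l = tieIdem q k l * tieIdem q i j := by
  refine eq_of_mul_eBar q fun A => ?_
  rw [mul_assoc, mul_assoc, tieIdem_mul_eBar, tieIdem_mul_eBar]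
  split_ifs with h₁ h₂ h₂ <;> simp [tieIdem_mul_eBar, h₁, h₂]

theorem tieIdem_mul_self (i j : Fin n) :
    tieIdem (𝕜 := 𝕜) q i j * tieIdem q i j = tieIdem q i j := by
  refine eq_of_mul_eBar q fun A => ?_
  rw [mul_assoc, tieIdem_mul_eBar]
  split_ifs with h₁ <;> simp [tieIdem_mul_eBar, h₁]

theorem tieIdem_mul_tieIdem (i j k : Fin n) :
    tieIdem (𝕜 := 𝕜) q i j * tieIdem q j k = tieIdem q i j * tieIdem q i k := by
  refine eq_of_mul_eBar q fun A => ?_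
  rw [mul_assoc, mul_assoc, tieIdem_mul_eBar, tieIdem_mul_eBar]
  by_cases h : A.toSetPar i j
  · have : A.toSetPar j k ↔ A.toSetPar i k :=
      ⟨fun h' => A.toSetPar.trans' h h', fun h' => A.toSetPar.trans' (A.toSetPar.symm' h) h'⟩
    by_cases h' : A.toSetPar i k
    · rw [if_pos h', if_pos (this.2 h')]
    · rw [if_neg h', if_neg (mt this.1 h')]
  · split_ifs <;> simp [tieIdem_mul_eBar, h]

theorem g_mul_tieIdem (a : Fin (n - 1)) (i j : Fin n) :
    g q a * tieIdem (𝕜 := 𝕜) q i j =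
      tieIdem q (simpleTransposition a i) (simpleTransposition a j) * g q a := by
  refine eq_of_mul_eBar q fun A => ?_
  rw [mul_assoc, mul_assoc, g_mul_eBar, ← mul_assoc (tieIdem _ _ _), tieIdem_mul_eBar,
    tieIdem_mul_eBar]
  by_cases h : A.toSetPar i j
  · rw [if_pos h, if_pos ((A.perm_toSetPar_apply _ i j).2 h), g_mul_eBar]
  · rw [if_neg h, if_neg (mt (A.perm_toSetPar_apply _ i j).1 h), mul_zero, zero_mul]

end OrdBT

/-! ### The embedding `ε₁` of the bt-algebra -/

namespace BT

variable {𝕜 : Type*} [Field 𝕜] (q : 𝕜) {n : ℕ}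

theorem simpleTransposition_near {a b : Fin (n - 1)} (h : Near a b) :
    (simpleTransposition b (simpleTransposition a (lo b)) = lo a ∧
      simpleTransposition b (simpleTransposition a (hi b)) = hi a) ∧
    ((lo b = hi a ∧ simpleTransposition b (lo a) = lo a ∧ simpleTransposition b (hi a) = hi b) ∨
      (hi b = lo a ∧ simpleTransposition b (hi a) = hi a ∧
        simpleTransposition b (lo a) = lo b)) := by
  rcases h with h | h
  · have hb : lo b = hi a := Fin.ext h.symm
    have h₁ : simpleTransposition a (hi b) = hi b := by
      apply simpleTransposition_of_ne <;> simp [hi] <;> omega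
    have h₂ : simpleTransposition b (lo a) = lo a := by
      apply simpleTransposition_of_ne <;> simp [lo] <;> omega
    refine ⟨⟨?_, ?_⟩, Or.inl ⟨hb, h₂, ?_⟩⟩
    · rw [hb, simpleTransposition_hi, h₂]
    · rw [h₁, simpleTransposition_hi, hb]
    · rw [← hb, simpleTransposition_lo]
  · have hb : hi b = lo a := Fin.ext h
    have h₁ : simpleTransposition a (lo b) = lo b := by
      apply simpleTransposition_of_ne <;> simp [lo] <;> omega
    have h₂ : simpleTransposition b (hi a) = hi a := by
      apply simpleTransposition_of_ne <;> simp [hi] <;> omega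
    refine ⟨⟨?_, ?_⟩, Or.inr ⟨hb, h₂, ?_⟩⟩
    · rw [h₁, simpleTransposition_lo, hb]
    · rw [hb, simpleTransposition_lo, h₂]
    · rw [← hb, simpleTransposition_hi]

/-- The relations of the bt-algebra become statements about the idempotents `OrdBT.tieIdem`: `g a`
permutes them through its transposition, and their products obey the transitivity of ties. -/
theorem exists_ordBT_hom_e : ∃ ε : BT 𝕜 q n →ₐ[𝕜] OrdBT 𝕜 q n,
    (∀ a, ε (g q a) = OrdBT.g q a) ∧ ∀ a, ε (e q a) = OrdBT.tieIdem q (lo a) (hi a) := by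
  -- Neighbouring generators share one position `l`. Naming the outer positions `k` and `m` treats
  -- both orders of `a` and `b` at once; `g b` exchanges `l` and `m`.
  have key : ∀ a b : Fin (n - 1), Near a b → ∃ k l m : Fin n,
      OrdBT.tieIdem (𝕜 := 𝕜) q (lo a) (hi a) = OrdBT.tieIdem q k l ∧
      OrdBT.tieIdem (𝕜 := 𝕜) q (lo b) (hi b) = OrdBT.tieIdem q l m ∧
      OrdBT.g q b * OrdBT.tieIdem (𝕜 := 𝕜) q (lo a) (hi a) =
        OrdBT.tieIdem q k m * OrdBT.g q b := by
    intro a b h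
    rcases (simpleTransposition_near h).2 with ⟨h₁, h₂, h₃⟩ | ⟨h₁, h₂, h₃⟩
    · exact ⟨lo a, hi a, hi b, rfl, by rw [h₁], by rw [OrdBT.g_mul_tieIdem, h₂, h₃]⟩
    · exact ⟨hi a, lo a, lo b, OrdBT.tieIdem_symm q _ _, by rw [OrdBT.tieIdem_symm, h₁],
        by rw [OrdBT.tieIdem_symm, OrdBT.g_mul_tieIdem, h₂, h₃]⟩
  have g_e : ∀ a : Fin (n - 1), OrdBT.g q a * OrdBT.tieIdem (𝕜 := 𝕜) q (lo a) (hi a) =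
      OrdBT.tieIdem q (lo a) (hi a) * OrdBT.g q a := fun a => by
    rw [OrdBT.g_mul_tieIdem, simpleTransposition_lo, simpleTransposition_hi, OrdBT.tieIdem_symm]
  refine exists_lift q (OrdBT.g q) (fun a => OrdBT.tieIdem q (lo a) (hi a)) g_e (OrdBT.braid q)
    (OrdBT.far q) ?_ ?_ ?_ (fun a b => OrdBT.tieIdem_commute q _ _ _ _) ?_ ?_ ?_
  · intro a b h
    have h' := (simpleTransposition_near h).1
    rw [mul_assoc (OrdBT.g q b), OrdBT.g_mul_tieIdem, ← mul_assoc, OrdBT.g_mul_tieIdem, h'.1, h'.2,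
      mul_assoc]
  · intro a b h
    obtain ⟨k, l, m, h₁, h₂, h₃⟩ := key a b h
    rw [mul_assoc _ (OrdBT.g q b), h₃, ← mul_assoc, h₁, h₂,
      OrdBT.tieIdem_mul_tieIdem]
  · intro a b h
    obtain ⟨k, l, m, h₁, h₂, h₃⟩ := key a b h
    rw [mul_assoc, h₃, mul_assoc (OrdBT.tieIdem q k m), g_e, ← mul_assoc, ← mul_assoc, h₁, h₂,
      OrdBT.tieIdem_commute, OrdBT.tieIdem_symm q l m, OrdBT.tieIdem_mul_tieIdem]
  · intro a b h
    have h₁ : simpleTransposition a (lo b) = lo b := by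
      apply simpleTransposition_of_ne <;> rcases h with h | h <;> simp [lo] <;> omega
    have h₂ : simpleTransposition a (hi b) = hi b := by
      apply simpleTransposition_of_ne <;> rcases h with h | h <;> simp [hi] <;> omega
    rw [OrdBT.g_mul_tieIdem, h₁, h₂]
  · intro a
    rw [sq, OrdBT.tieIdem_mul_self]
  · intro a
    rw [OrdBT.g_sq, g_e]

variable {q} (hq : q ≠ 0) (ε : BT 𝕜 q n →ₐ[𝕜] OrdBT 𝕜 q n)
  (hg : ∀ a, ε (g q a) = OrdBT.g q a)
  (he : ∀ a, ε (e q a) = OrdBT.tieIdem q (lo a) (hi a))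

include hq hg he

theorem map_tie (i j : Fin n) : ε (tie q i j) = OrdBT.tieIdem q i j := by
  have key : ∀ a k (h : a + k + 1 < n), ε (tieAux q a k h) =
      OrdBT.tieIdem q ⟨a, by omega⟩ ⟨a + k + 1, h⟩ := by
    intro a k h
    induction k with
    | zero =>
      rw [tieAux, he]
      rfl
    | succ k ih =>
      set b : Fin (n - 1) := ⟨a + k + 1, by omega⟩ with hb
      have h₁ : simpleTransposition b ⟨a, by omega⟩ = ⟨a, by omega⟩ := by
        apply simpleTransposition_of_ne <;> simp [hb] <;> omega
      have h₂ : simpleTransposition b ⟨a + k + 1, by omega⟩ = ⟨a + (k + 1) + 1, h⟩ :=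
        simpleTransposition_lo b
      have h₃ : OrdBT.g q b * ε (gInv q b) = 1 := by
        rw [← hg, ← map_mul, g_mul_gInv hq, map_one]
      rw [tieAux, map_mul, map_mul, ih, hg, OrdBT.g_mul_tieIdem, h₁, h₂, mul_assoc, h₃, mul_one]
  rcases lt_trichotomy i j with h | rfl | h
  · rw [tie, dif_pos h, key]
    congr 1
    ext
    simp only
    omega
  · rw [tie_self, map_one, OrdBT.tieIdem_self]
  · rw [tie_comm hq, tie, dif_pos h, key, OrdBT.tieIdem_symm]
    congr 1
    ext
    simp only
    omega

open Classical in
theorem map_eA_mul_eBar (A : SetPar n) (C : OrdSetPar n) :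
    ε (eA q A) * OrdBT.eBar q C = if A ≤ C.toSetPar then OrdBT.eBar q C else 0 := by
  have key : ∀ l : List (Fin n × Fin n), ε (l.map fun x => tie q x.1 x.2).prod * OrdBT.eBar q C =
      if ∀ x ∈ l, C.toSetPar x.1 x.2 then OrdBT.eBar q C else 0 := by
    intro l
    induction l with
    | nil => simp
    | cons x l ih =>
      rw [List.map_cons, List.prod_cons, map_mul, mul_assoc, ih, map_tie hq ε hg he]
      simp only [List.forall_mem_cons]
      by_cases h₁ : ∀ x ∈ l, C.toSetPar x.1 x.2
      · rw [if_pos h₁, OrdBT.tieIdem_mul_eBar]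
        exact if_congr (iff_self_and.2 fun _ => h₁) rfl rfl
      · rw [if_neg h₁, if_neg fun h => h₁ h.2, mul_zero]
  rw [eA, key]
  refine if_congr ⟨fun h i j hij => h (i, j) ?_, fun h x hx => h ?_⟩ rfl rfl
  · simpa using hij
  · simpa using (List.mem_filter.1 hx).2

open Classical in
-- After right multiplication by `ē(C)` only the `B` with `A ≤ B ≤ C` survive, and the Möbius
-- function sums to zero over such an interval unless `A` is the set partition underlying `C`.
theorem map_eBar (A : SetPar n) : ε (eBar q A) =
    ∑ B ∈ Finset.univ.filter (fun B : OrdSetPar n => B.toSetPar = A), OrdBT.eBar q B := by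
  refine OrdBT.eq_of_mul_eBar q fun C => ?_
  rw [OrdBT.sum_filter_mul_eBar, eBar, map_sum, Finset.sum_mul]
  have h₁ : ∀ B : SetPar n, ε (((IncidenceAlgebra.mu ℤ A B : ℤ) : 𝕜) • eA q B) * OrdBT.eBar q C =
      if B ≤ C.toSetPar then ((IncidenceAlgebra.mu ℤ A B : ℤ) : 𝕜) • OrdBT.eBar q C else 0 := by
    intro B
    rw [map_smul, smul_mul_assoc, map_eA_mul_eBar hq ε hg he]
    split_ifs <;> simp
  rw [Finset.sum_congr rfl fun B _ => h₁ B, ← Finset.sum_filter, Finset.filter_filter]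
  have h₂ : (Finset.univ.filter fun B : SetPar n => A ≤ B ∧ B ≤ C.toSetPar) =
      Finset.Icc A C.toSetPar := by
    ext B
    simp
  rw [h₂, ← Finset.sum_smul, ← Int.cast_sum, IncidenceAlgebra.sum_Icc_mu_right]
  by_cases h : A = C.toSetPar
  · simp [h]
  · simp [h, Ne.symm h]

/-- Every set partition underlies some ordered one, so the images of the spanning family are
independent. In particular, independence in the bt-algebra is inherited from the larger algebra and
needs no module of its own. -/
theorem ordBT_hom_injective (hn : 0 < n) : Function.Injective ε := by
  classical
  refine injective_of_span_of_linearIndependent ε.toLinearMap _ (span_nf hq) ?_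
  convert OrdBT.linearIndependent_sum_nf (𝕜 := 𝕜) q (OrdSetPar.toSetPar (n := n))
    OrdSetPar.exists_toSetPar_eq (n - 1) (by omega) using 1
  · funext y
    have h₁ : ε (nf (natExt (g q)) (n - 1) y.1) = nf (natExt (OrdBT.g q)) (n - 1) y.1 := by
      rw [← funext hg]
      exact map_nf_natExt (ε : BT 𝕜 q n →* OrdBT 𝕜 q n) _ _ _
    rw [AlgHom.toLinearMap_apply, map_mul, h₁, map_eBar hq ε hg he]
  · rfl

end BT

end BraidsTies

theorem mainTheorem3 {𝕜 : Type*} [Field 𝕜] (q : 𝕜) (hq : q ≠ 0) (n : ℕ) (hn : 0 < n) :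
    (∀ (d : ℕ) (ξ : 𝕜), (d : 𝕜) ≠ 0 → n ≤ d → IsPrimitiveRoot ξ d →
      (∃ ε : BraidsTies.OrdBT 𝕜 q n →ₐ[𝕜] BraidsTies.YokonumaHecke 𝕜 q d n,
        (∀ a : Fin (n - 1), ε (BraidsTies.OrdBT.g q a) = BraidsTies.YokonumaHecke.g q d a) ∧
        (∀ A : BraidsTies.OrdSetPar n,
          ε (BraidsTies.OrdBT.eBar q A) = BraidsTies.YokonumaHecke.eBar q d ξ A) ∧
        Function.Injective ε) ∧
      (∃ ε₁ : BraidsTies.BT 𝕜 q n →ₐ[𝕜] BraidsTies.OrdBT 𝕜 q n,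
        (∀ a : Fin (n - 1), ε₁ (BraidsTies.BT.g q a) = BraidsTies.OrdBT.g q a) ∧
        (∀ A : BraidsTies.SetPar n,
          ε₁ (BraidsTies.BT.eBar q A) =
            ∑ B ∈ Finset.univ.filter (fun B : BraidsTies.OrdSetPar n => B.toSetPar = A),
              BraidsTies.OrdBT.eBar q B) ∧
        Function.Injective ε₁)) ∧
    Module.Finite 𝕜 (BraidsTies.OrdBT 𝕜 q n) ∧
    Module.finrank 𝕜 (BraidsTies.OrdBT 𝕜 q n) = n.factorial * BraidsTies.fubini n := by
  refine ⟨fun d ξ hd hnd hξ => ⟨?_, ?_⟩, Module.Finite.of_basis (BraidsTies.OrdBT.basis q hn),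
    BraidsTies.OrdBT.finrank_eq q hn⟩
  · obtain ⟨ε, hg, he⟩ := BraidsTies.YokonumaHecke.exists_ordBT_hom q hξ hd (n := n)
    exact ⟨ε, hg, he, BraidsTies.YokonumaHecke.ordBT_hom_injective q hξ hd hn hnd ε hg he⟩
  · obtain ⟨ε, hg, he⟩ := BraidsTies.BT.exists_ordBT_hom_e q (n := n)
    refine ⟨ε, hg, fun A => ?_, BraidsTies.BT.ordBT_hom_injective hq ε hg he hn⟩
    rw [BraidsTies.BT.map_eBar hq ε hg he]
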